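/- Let $B(z)=e^{i\theta}\prod_{k=1}^{d}\frac{z-a_k}{1-\overline{a_k}z}$ ($|a_k|<1$) be a Blaschke product of degree $d$ that is canonical, i.e. $\theta=0$ and $B(0)=0$. The exterior curve $E_B\subset\mathbb{C}$ is the set of all intersection points of two distinct lines tangent to the unit circle at points of $B^{-1}(\lambda)$, as $\lambda$ ranges over $\partial\mathbb{D}$. The interior curve $I_B\subset\mathbb{C}$ is the envelope of the family of all lines joining two distinct points of $B^{-1}(\lambda)$, $\lambda=e^{it}\in\partial\mathbb{D}$, i.e. the set of points $\zeta$ such that $F(\zeta,t_0)=0$ and $\partial_tF(\zeta,t_0)=0$ for some $t_0\in\mathbb R$ and some $C^1$ local branch $F(\cdot,t)=0$ of this family of lines near $t_0$. Identify $\mathbb{C}$ with the affine part of $\mathbb{P}_2(\mathbb{R})$ by $x+iy\mapsto(x:y:1)$, and the line $aX+bY+cW=0$ with the point $(a:b:c)$ of $\mathbb{P}_2^*(\mathbb{R})$, whose affine part is identified with $\mathbb{C}$ in the same way. Let $I_B^*\subset\mathbb{P}_2^*(\mathbb{R})$ be the dual curve of the homogenization (closure in $\mathbb{P}_2(\mathbb{R})$)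 of $I_B$, i.e. the set of all lines tangent to it at one of its points; here a tangent line at $p$ is a limit of secants joining $p$ to points of the curve converging to $p$, and at an isolated point every line through the point counts as tangent. Then the affine part of $I_B^*$ has a defining equation $v_B^*(z)=0$, where $v_B^*$ is a nonzero polynomial in $z$ and $\overline z$; and for every such defining equation, the exterior curve is given by $$E_B:\ v_B^*(-z)=0,\qquad\text{i.e.}\quad E_B=\{z\in\mathbb{C}: v_B^*(-z)=0\}.$$ -/

import Mathlib

open scoped ComplexConjugate LinearAlgebra.Projectivization
open Filter Topology

/-! ### Blaschke products -/

/-- The Blaschke product `e^{iθ} ∏ k, (z - a k) / (1 - conj (a k) * z)` of degree `d`. -/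
noncomputable def blaschke {d : ℕ} (θ : ℝ) (a : Fin d → ℂ) (z : ℂ) : ℂ :=
  Complex.exp (θ * Complex.I) * ∏ k, (z - a k) / (1 - conj (a k) * z)

/-- A Blaschke product is canonical if `θ = 0` and it vanishes at the origin. -/
def IsCanonical {d : ℕ} (θ : ℝ) (a : Fin d → ℂ) : Prop :=
  θ = 0 ∧ blaschke θ a 0 = 0

/-! ### The exterior curve -/

/-- The tangent line of the unit circle at a point `z` of the circle. -/
def circleTangent (z : ℂ) : Set ℂ :=
  {ζ | (conj z * (ζ - z)).re = 0}

/-- The set of tangent lines of the unit circle at the preimages of `c` under `B`. -/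
def tangentLines (B : ℂ → ℂ) (c : ℂ) : Set (Set ℂ) :=
  circleTangent '' (B ⁻¹' {c})

/-- The exterior curve: the trace of the intersection points of two distinct tangent lines at
preimages of `c`, as `c` ranges over the unit circle. -/
def exteriorCurve (B : ℂ → ℂ) : Set ℂ :=
  {ζ | ∃ c : ℂ, ‖c‖ = 1 ∧ ∃ l ∈ tangentLines B c, ∃ m ∈ tangentLines B c,
    l ≠ m ∧ ζ ∈ l ∧ ζ ∈ m}

/-! ### The interior curve -/

/-- The pairs of distinct preimages of `c` under `B`; each of them spans one of the lines that
join two preimages of `c`. -/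
def chords (B : ℂ → ℂ) (c : ℂ) : Set (ℂ × ℂ) :=
  {p | p.1 ≠ p.2 ∧ B p.1 = c ∧ B p.2 = c}

/-- For `p ≠ q`, the equation `lineEq p q ζ = 0` in `ζ` defines the real line joining `p`, `q`. -/
def lineEq (p q ζ : ℂ) : ℝ :=
  ((ζ - p) * conj (q - p)).im

/-- The interior curve: the envelope of the family of the lines joining two distinct preimages
of `e^{it}`. In terms of a local branch `F(ζ, t) = 0` of this family of lines, a point of the
envelope is a point `ζ` with `F(ζ, t₀) = 0` and `∂F/∂t (ζ, t₀) = 0` for some parameter `t₀`. -/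
def interiorCurve (B : ℂ → ℂ) : Set ℂ :=
  {ζ | ∃ (t₀ : ℝ) (p q : ℝ → ℂ), ContDiffAt ℝ 1 p t₀ ∧ ContDiffAt ℝ 1 q t₀ ∧
    (∀ᶠ t : ℝ in 𝓝 t₀, (p t, q t) ∈ chords B (Complex.exp (t * Complex.I))) ∧
    lineEq (p t₀) (q t₀) ζ = 0 ∧
    HasDerivAt (fun t => lineEq (p t) (q t) ζ) 0 t₀}

/-! ### The real projective plane, its dual, and dual curves -/

/-- The real projective plane. A point `(a : b : c)` of the dual plane, that is, the line
`a X + b Y + c W = 0`, is given by its homogeneous coordinates too; the incidence of the line `L`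
and the point `P` is `Projectivization.orthogonal L P`. -/
abbrev RealPlane : Type := ℙ ℝ (Fin 3 → ℝ)

/-- Convergence of sequences in the (dual) real projective plane. -/
def ProjTendsto (P : ℕ → RealPlane) (Q : RealPlane) : Prop :=
  ∃ (p : ℕ → Fin 3 → ℝ) (q : Fin 3 → ℝ) (hp : ∀ n, p n ≠ 0) (hq : q ≠ 0),
    (∀ n, Projectivization.mk ℝ (p n) (hp n) = P n) ∧ Projectivization.mk ℝ q hq = Q ∧
    Tendsto p atTop (𝓝 q)

theorem affine_ne_zero (z : ℂ) : (![z.re, z.im, 1] : Fin 3 → ℝ) ≠ 0 := by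
  intro h
  simpa using congrFun h 2

/-- The complex plane as the affine part of the projective plane, `x + iy ↦ (x : y : 1)`. -/
noncomputable def toProj (z : ℂ) : RealPlane :=
  Projectivization.mk ℝ ![z.re, z.im, 1] (affine_ne_zero z)

/-- The homogenization of a plane curve: its closure in the projective plane. -/
def homogenization (C : Set ℂ) : Set RealPlane :=
  {Q | ∃ z : ℕ → ℂ, (∀ n, z n ∈ C) ∧ ProjTendsto (fun n => toProj (z n)) Q}

/-- The affine part of a subset of the (dual) projective plane. -/
def affinePart (S : Set RealPlane) : Set ℂ :=
  toProj ⁻¹' S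

/-- `P` is an isolated point of `C`. -/
def IsIsolatedIn (C : Set RealPlane) (P : RealPlane) : Prop :=
  P ∈ C ∧ ¬ ∃ R : ℕ → RealPlane, (∀ n, R n ∈ C ∧ R n ≠ P) ∧ ProjTendsto R P

/-- `L` is tangent to `C` at `P`: it is a line through `P` and a limit of secants of `C` joining
`P` to points of `C` that converge to `P`. At an isolated point of `C` (where `C` reduces to a
point and the tangent space has dimension zero) every line through the point is tangent. -/
def IsTangentAt (C : Set RealPlane) (L P : RealPlane) : Prop :=
  P ∈ C ∧ Projectivization.orthogonal L P ∧
    (IsIsolatedIn C P ∨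
      ∃ R M : ℕ → RealPlane,
        (∀ n, R n ∈ C ∧ R n ≠ P ∧
          Projectivization.orthogonal (M n) P ∧ Projectivization.orthogonal (M n) (R n)) ∧
        ProjTendsto R P ∧ ProjTendsto M L)

/-- The dual curve: the set of all lines that are tangent to `C` at some point of `C`. -/
def dualCurve (C : Set RealPlane) : Set RealPlane :=
  {L | ∃ P, IsTangentAt C L P}

/-! ### Defining equations -/

/-- The value at `z` of a polynomial in `z` and `conj z`. -/
noncomputable def evalZ (v : MvPolynomial (Fin 2) ℂ) (z : ℂ) : ℂ :=
  MvPolynomial.eval ![z, conj z] v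

/-- `v(z) = 0` is a defining equation of the plane set `S`, where `v` is a nonzero polynomial
in `z` and `conj z`. -/
def IsDefiningEquation (v : MvPolynomial (Fin 2) ℂ) (S : Set ℂ) : Prop :=
  v ≠ 0 ∧ S = {z | evalZ v z = 0}

/-! Everything is governed by the pairs p ≠ q on the unit circle with B p = B q (`IsChord`). On the
circle z B'/B is positive, so the preimages of e^{it} move along analytic branches with P' = i P /
`weight`. The line pq has the equation z + p q conj z = p + q. Solving it together with its
t-derivative leaves a single point, the weighted mean `envPoint`, which lies inside the disc. Hence
the interior curve is the set of these points (`interiorCurve_eq`); it is compact, so its closure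
adds nothing at infinity.

The chord pq is the tangent at its envelope point. Differentiating the chord equation along a branch
shows that the velocity is parallel to the chord, and by analyticity a nonconstant branch has
secants converging to the chord, even at a cusp (`exists_direction`). If a branch is constant, the
identity theorem makes every line through the point a chord line; such points are exactly the
isolated ones, and there the convention on tangents supplies exactly these lines. So the dual curve
consists of the chord lines (`mem_affinePart_iff`).

The line with coordinates (w : 1) contains p iff Re(w conj p) = -1, that is, iff -w lies on the
tangent of the circle at p. Chord lines thus correspond to intersections of tangents under w ↦ -w,
which gives the second claim for any defining equation.

For the existence of an equation, let B = N/D. The points of the line w on the circle are the roots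
p, q of conj w X² + 2X + w, so conj w (p + q) = -2 and conj w · pq = w. The quotient (N(p)D(q) -
N(q)D(p))/(p - q) is symmetric, and times (conj w)^(d-1) it becomes a polynomial in w and conj w. It
must not vanish for |w| ≤ 1: for 0 < |w| < 1 the roots are separated by the circle, for |w| = 1 they
coincide and B' ≠ 0 decides, and at w = 0 the normalization B(0) = 0 enters. -/

/-! ### Coverings of the unit circle -/

/-- The logarithmic derivative `z B'(z) / B(z)`. -/
noncomputable def weight (B : ℂ → ℂ) (z : ℂ) : ℂ :=
  z * deriv B z / B z

/-- A function that is analytic at the unit circle, which is its own full preimage, and moves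
along it with positive speed. -/
structure CircleCover (B : ℂ → ℂ) : Prop where
  norm_eq_one_iff : ∀ z, ‖B z‖ = 1 ↔ ‖z‖ = 1
  analyticAt : ∀ z, ‖z‖ = 1 → AnalyticAt ℂ B z
  weight_pos : ∀ z, ‖z‖ = 1 → ∃ r : ℝ, 0 < r ∧ weight B z = r

/-- `p` and `q` are distinct points of the unit circle with the same image under `B`. -/
structure IsChord (B : ℂ → ℂ) (p q : ℂ) : Prop where
  norm_left : ‖p‖ = 1
  norm_right : ‖q‖ = 1
  ne : p ≠ q
  map_eq : B p = B q

/-- The point in which the chord `p q` touches the envelope. -/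
noncomputable def envPoint (B : ℂ → ℂ) (p q : ℂ) : ℂ :=
  (weight B p * p + weight B q * q) / (weight B p + weight B q)

/-- `P` is a local branch of the inverse of `B` along the unit circle. -/
structure IsBranch (B : ℂ → ℂ) (P : ℝ → ℂ) (t₀ : ℝ) : Prop where
  analyticAt : AnalyticAt ℝ P t₀
  map_eq : ∀ᶠ t : ℝ in 𝓝 t₀, B (P t) = Complex.exp (t * Complex.I)
  unique : ∀ᶠ x : ℂ × ℝ in 𝓝 (P t₀, t₀), B x.1 = Complex.exp (x.2 * Complex.I) → x.1 = P x.2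

theorem conj_eq_inv_of_norm_eq_one {z : ℂ} (hz : ‖z‖ = 1) : conj z = z⁻¹ := by
  rw [Complex.inv_def, Complex.normSq_eq_norm_sq, hz]
  simp

theorem ne_zero_of_norm_eq_one {z : ℂ} (hz : ‖z‖ = 1) : z ≠ 0 := by
  rintro rfl
  simp at hz

theorem exists_exp_of_norm_eq_one {z : ℂ} (hz : ‖z‖ = 1) :
    ∃ t : ℝ, z = Complex.exp (t * Complex.I) :=
  ⟨z.arg, by simpa [hz] using (Complex.norm_mul_exp_arg_mul_I z).symm⟩

theorem hasDerivAt_exp_mul_I (t : ℝ) :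
    HasDerivAt (fun t : ℝ => Complex.exp (t * Complex.I))
      (Complex.I * Complex.exp (t * Complex.I)) t := by
  have h := ((Complex.ofRealCLM.hasDerivAt (x := t)).mul_const Complex.I).cexp
  simpa [mul_comm] using h

theorem analyticAt_exp_mul_I (t : ℝ) :
    AnalyticAt ℝ (fun t : ℝ => Complex.exp (t * Complex.I)) t := by
  have h1 : AnalyticAt ℝ Complex.exp ((t : ℂ) * Complex.I) :=
    (Complex.differentiable_exp.analyticAt _).restrictScalars
  have h2 : AnalyticAt ℝ (fun t : ℝ => (t : ℂ) * Complex.I) t :=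
    (Complex.ofRealCLM.analyticAt t).mul analyticAt_const
  exact h1.comp_of_eq h2 rfl

theorem IsChord.symm {B : ℂ → ℂ} {p q : ℂ} (h : IsChord B p q) : IsChord B q p :=
  ⟨h.norm_right, h.norm_left, h.ne.symm, h.map_eq.symm⟩

namespace CircleCover

variable {B : ℂ → ℂ} (h : CircleCover B)
include h

theorem weight_ne_zero {z : ℂ} (hz : ‖z‖ = 1) : weight B z ≠ 0 := by
  obtain ⟨r, hr, e⟩ := h.weight_pos z hz
  rw [e]
  exact_mod_cast hr.ne'

theorem deriv_ne_zero {z : ℂ} (hz : ‖z‖ = 1) : deriv B z ≠ 0 := by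
  intro h0
  exact h.weight_ne_zero hz (by simp [weight, h0])

theorem exists_injOn {z : ℂ} (hz : ‖z‖ = 1) : ∃ U ∈ 𝓝 z, Set.InjOn B U := by
  have hd := (h.analyticAt z hz).hasStrictDerivAt
  have := hd.eventually_left_inverse (h.deriv_ne_zero hz)
  refine ⟨_, this, fun x hx y hy hxy => ?_⟩
  simp only [Set.mem_ofPred_eq] at hx hy
  rw [← hx, ← hy, hxy]

theorem exists_branch {p : ℂ} (hp : ‖p‖ = 1) {t₀ : ℝ} (ht : B p = Complex.exp (t₀ * Complex.I)) :
    ∃ P : ℝ → ℂ, P t₀ = p ∧ IsBranch B P t₀ := by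
  have ha := h.analyticAt p hp
  have hd := h.deriv_ne_zero hp
  set r := ha.hasStrictDerivAt.localInverse _ _ _ hd with hr
  have hra : AnalyticAt ℂ r (B p) := ha.analyticAt_localInverse hd
  have hrp : r (B p) = p := HasStrictFDerivAt.localInverse_apply_image ..
  have hright : ∀ᶠ x in 𝓝 (B p), B (r x) = x :=
    ha.hasStrictDerivAt.eventually_right_inverse hd
  have hleft : ∀ᶠ x in 𝓝 p, r (B x) = x := ha.hasStrictDerivAt.eventually_left_inverse hd
  refine ⟨fun t => r (Complex.exp (t * Complex.I)), by simp only [← ht, hrp], ?_, ?_, ?_⟩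
  · exact (hra.restrictScalars (𝕜 := ℝ)).comp_of_eq (analyticAt_exp_mul_I t₀) ht.symm
  · have hc : Tendsto (fun t : ℝ => Complex.exp (t * Complex.I)) (𝓝 t₀) (𝓝 (B p)) := by
      rw [ht]
      exact (analyticAt_exp_mul_I t₀).continuousAt
    exact hc.eventually hright
  · have e : r (Complex.exp (t₀ * Complex.I)) = p := by rw [← ht, hrp]
    simp only [e]
    have hf : Tendsto (Prod.fst : ℂ × ℝ → ℂ) (𝓝 (p, t₀)) (𝓝 p) := continuousAt_fst
    filter_upwards [hf.eventually hleft] with x hx hx'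
    rw [← hx', hx]

/-- Only differentiability of the branch is assumed, because the envelope is defined by arbitrary C¹
branches and not just by those of `exists_branch`. -/
theorem hasDerivAt_of_map_eq {P : ℝ → ℂ} {t : ℝ} (hP : DifferentiableAt ℝ P t)
    (hB : ∀ᶠ t : ℝ in 𝓝 t, B (P t) = Complex.exp (t * Complex.I)) :
    HasDerivAt P (Complex.I * P t / weight B (P t)) t := by
  have e := hB.self_of_nhds
  have hn : ‖P t‖ = 1 := by
    rw [← h.norm_eq_one_iff, e, Complex.norm_exp_ofReal_mul_I]
  have h1 : HasDerivAt (B ∘ P) (deriv B (P t) * deriv P t) t :=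
    (h.analyticAt _ hn).differentiableAt.hasDerivAt.comp t hP.hasDerivAt
  have h2 := (hasDerivAt_exp_mul_I t).congr_of_eventuallyEq (f₁ := B ∘ P) hB
  have h3 := h1.unique h2
  have hd := h.deriv_ne_zero hn
  have hz := ne_zero_of_norm_eq_one hn
  have hB0 : B (P t) ≠ 0 := ne_zero_of_norm_eq_one ((h.norm_eq_one_iff _).2 hn)
  have : deriv P t = Complex.I * P t / weight B (P t) := by
    rw [← e] at h3
    simp only [weight]
    field_simp
    linear_combination h3
  rw [← this]
  exact hP.hasDerivAt

theorem norm_eq_one_of_map_eq_exp {z : ℂ} {t : ℝ} (e : B z = Complex.exp (t * Complex.I)) :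
    ‖z‖ = 1 := by
  rw [← h.norm_eq_one_iff, e, Complex.norm_exp_ofReal_mul_I]

/-- The angle is t₀ + arg (B z / B p); dividing by B p keeps the argument near 1, away from the cut.
-/
theorem eventually_exists_angle {p : ℂ} (hp : ‖p‖ = 1) {t₀ : ℝ}
    (ht : B p = Complex.exp (t₀ * Complex.I)) {V : Set ℝ} (hV : V ∈ 𝓝 t₀) :
    ∀ᶠ z in 𝓝 p, ‖z‖ = 1 → ∃ t ∈ V, B z = Complex.exp (t * Complex.I) := by
  have hB0 : B p ≠ 0 := ne_zero_of_norm_eq_one ((h.norm_eq_one_iff _).2 hp)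
  have hc : ContinuousAt (fun z => t₀ + (B z / B p).arg) p := by
    have h1 : ContinuousAt (fun z => B z / B p) p :=
      (h.analyticAt p hp).continuousAt.div_const _
    have h2 : ContinuousAt Complex.arg (B p / B p) := by
      rw [div_self hB0]
      exact Complex.continuousAt_arg (by simp)
    exact continuousAt_const.add (ContinuousAt.comp_of_eq h2 h1 rfl)
  have hV' : V ∈ 𝓝 (t₀ + (B p / B p).arg) := by simpa [div_self hB0] using hV
  filter_upwards [hc.preimage_mem_nhds hV'] with z hz hzn
  refine ⟨_, hz, ?_⟩
  have hn : ‖B z / B p‖ = 1 := by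
    rw [norm_div, (h.norm_eq_one_iff _).2 hzn, (h.norm_eq_one_iff _).2 hp, div_one]
  have e := Complex.norm_mul_exp_arg_mul_I (B z / B p)
  rw [hn, Complex.ofReal_one, one_mul] at e
  push_cast
  rw [add_mul, Complex.exp_add, e, ← ht]
  field_simp

/-! ### The chord equation and the envelope -/

/-- Both p and q satisfy z + p q conj z = p + q, and `envPoint` is a real affine combination of
them. -/
theorem envPoint_chord {p q : ℂ} (hp : ‖p‖ = 1) (hq : ‖q‖ = 1) :
    envPoint B p q + p * q * conj (envPoint B p q) = p + q := by
  obtain ⟨r, hr, er⟩ := h.weight_pos p hp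
  obtain ⟨s, hs, es⟩ := h.weight_pos q hq
  have hp0 := ne_zero_of_norm_eq_one hp
  have hq0 := ne_zero_of_norm_eq_one hq
  have hrs : (r : ℂ) + s ≠ 0 := by exact_mod_cast (add_pos hr hs).ne'
  simp only [envPoint, er, es, map_div₀, map_add, map_mul, Complex.conj_ofReal,
    conj_eq_inv_of_norm_eq_one hp, conj_eq_inv_of_norm_eq_one hq]
  field_simp
  ring

/-- This is the derivative of the product pq along the branches, equal to i p q (1/r + 1/s) with
positive weights r, s. Therefore the differentiated chord equation has only one solution z. -/
theorem speed_ne_zero {p q : ℂ} (hp : ‖p‖ = 1) (hq : ‖q‖ = 1) :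
    Complex.I * p / weight B p * q + p * (Complex.I * q / weight B q) ≠ 0 := by
  obtain ⟨r, hr, er⟩ := h.weight_pos p hp
  obtain ⟨s, hs, es⟩ := h.weight_pos q hq
  have hp0 := ne_zero_of_norm_eq_one hp
  have hq0 := ne_zero_of_norm_eq_one hq
  have hr0 : (r : ℂ) ≠ 0 := by exact_mod_cast hr.ne'
  have hs0 : (s : ℂ) ≠ 0 := by exact_mod_cast hs.ne'
  have hrs : (s : ℂ) + r ≠ 0 := by exact_mod_cast (add_pos hs hr).ne'
  have : Complex.I * p / weight B p * q + p * (Complex.I * q / weight B q)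
      = Complex.I * p * q * (s + r) / (r * s) := by
    rw [er, es]
    field_simp
  rw [this]
  exact div_ne_zero (mul_ne_zero (mul_ne_zero (mul_ne_zero Complex.I_ne_zero hp0) hq0) hrs)
    (mul_ne_zero hr0 hs0)

theorem envPoint_speed {p q : ℂ} (hp : ‖p‖ = 1) (hq : ‖q‖ = 1) :
    (Complex.I * p / weight B p * q + p * (Complex.I * q / weight B q)) *
      conj (envPoint B p q) = Complex.I * p / weight B p + Complex.I * q / weight B q := by
  obtain ⟨r, hr, er⟩ := h.weight_pos p hp
  obtain ⟨s, hs, es⟩ := h.weight_pos q hq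
  have hp0 := ne_zero_of_norm_eq_one hp
  have hq0 := ne_zero_of_norm_eq_one hq
  have hr0 : (r : ℂ) ≠ 0 := by exact_mod_cast hr.ne'
  have hs0 : (s : ℂ) ≠ 0 := by exact_mod_cast hs.ne'
  have hrs : (r : ℂ) + s ≠ 0 := by exact_mod_cast (add_pos hr hs).ne'
  simp only [envPoint, er, es, map_div₀, map_add, map_mul, Complex.conj_ofReal,
    conj_eq_inv_of_norm_eq_one hp, conj_eq_inv_of_norm_eq_one hq]
  field_simp
  ring

theorem eq_envPoint_of_speed {p q z : ℂ} (hp : ‖p‖ = 1) (hq : ‖q‖ = 1)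
    (hz : (Complex.I * p / weight B p * q + p * (Complex.I * q / weight B q)) * conj z
      = Complex.I * p / weight B p + Complex.I * q / weight B q) :
    z = envPoint B p q := by
  have := mul_left_cancel₀ (h.speed_ne_zero hp hq) (hz.trans (h.envPoint_speed hp hq).symm)
  exact (starRingEnd ℂ).injective this

theorem norm_envPoint_lt_one {p q : ℂ} (hp : ‖p‖ = 1) (hq : ‖q‖ = 1) (hpq : p ≠ q) :
    ‖envPoint B p q‖ < 1 := by
  obtain ⟨r, hr, er⟩ := h.weight_pos p hp
  obtain ⟨s, hs, es⟩ := h.weight_pos q hq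
  have hrs : 0 < r + s := add_pos hr hs
  have hrs' : (r : ℂ) + s ≠ 0 := by exact_mod_cast hrs.ne'
  have e : envPoint B p q = (r / (r + s)) • p + (s / (r + s)) • q := by
    simp only [envPoint, er, es, Complex.real_smul]
    push_cast
    field_simp
  rw [e]
  exact norm_combo_lt_of_ne hp.le hq.le hpq (by positivity) (by positivity) (by field_simp)

end CircleCover

/-! ### The interior curve as the set of envelope points -/

theorem lineEq_eq {p q z : ℂ} (hp : ‖p‖ = 1) (hq : ‖q‖ = 1) :
    (lineEq p q z : ℂ) =
      Complex.I / 2 * ((q - p) / (p * q)) * (z + p * q * conj z - p - q) := by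
  have hp0 := ne_zero_of_norm_eq_one hp
  have hq0 := ne_zero_of_norm_eq_one hq
  rw [lineEq, Complex.im_eq_sub_conj]
  simp only [map_mul, map_sub, conj_eq_inv_of_norm_eq_one hp, conj_eq_inv_of_norm_eq_one hq,
    map_inv₀, inv_inv]
  have : (2 * Complex.I)⁻¹ = - Complex.I / 2 := by
    rw [mul_inv, Complex.inv_I]; ring
  rw [div_eq_mul_inv, this]
  field_simp
  ring

theorem lineEq_eq_zero_iff {p q z : ℂ} (hp : ‖p‖ = 1) (hq : ‖q‖ = 1) (hpq : p ≠ q) :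
    lineEq p q z = 0 ↔ z + p * q * conj z = p + q := by
  have hp0 := ne_zero_of_norm_eq_one hp
  have hq0 := ne_zero_of_norm_eq_one hq
  rw [← Complex.ofReal_inj, lineEq_eq hp hq, Complex.ofReal_zero, mul_eq_zero, mul_eq_zero,
    sub_sub, sub_eq_zero]
  simp [hp0, hq0, sub_eq_zero, hpq.symm]

theorem interiorCurve_eq {B : ℂ → ℂ} (h : CircleCover B) :
    interiorCurve B = {z | ∃ p q, IsChord B p q ∧ z = envPoint B p q} := by
  have key : ∀ (t₀ : ℝ) (p q : ℝ → ℂ) (z : ℂ), DifferentiableAt ℝ p t₀ → DifferentiableAt ℝ q t₀ →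
      (∀ᶠ t : ℝ in 𝓝 t₀, (p t, q t) ∈ chords B (Complex.exp (t * Complex.I))) →
      lineEq (p t₀) (q t₀) z = 0 →
      (HasDerivAt (fun t => lineEq (p t) (q t) z) 0 t₀ ↔
        (Complex.I * p t₀ / weight B (p t₀) * q t₀ + p t₀ * (Complex.I * q t₀ / weight B (q t₀)))
          * conj z
        = Complex.I * p t₀ / weight B (p t₀) + Complex.I * q t₀ / weight B (q t₀)) := by
    intro t₀ p q z hp hq hc hl
    have hc0 := hc.self_of_nhds
    have hpn := h.norm_eq_one_of_map_eq_exp hc0.2.1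
    have hqn := h.norm_eq_one_of_map_eq_exp hc0.2.2
    have hp0 := ne_zero_of_norm_eq_one hpn
    have hq0 := ne_zero_of_norm_eq_one hqn
    have hl' := (lineEq_eq_zero_iff hpn hqn hc0.1).1 hl
    have hP := h.hasDerivAt_of_map_eq hp (hc.mono fun t ht => ht.2.1)
    have hQ := h.hasDerivAt_of_map_eq hq (hc.mono fun t ht => ht.2.2)
    set p' := Complex.I * p t₀ / weight B (p t₀)
    set q' := Complex.I * q t₀ / weight B (q t₀)
    have hC : HasDerivAt (fun t => z + p t * q t * conj z - p t - q t)
        ((p' * q t₀ + p t₀ * q') * conj z - p' - q') t₀ :=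
      ((((hP.mul hQ).mul_const (conj z)).const_add z).sub hP).sub hQ
    have hK : DifferentiableAt ℝ (fun t => Complex.I / 2 * ((q t - p t) / (p t * q t))) t₀ :=
      ((hq.sub hp).div (hp.mul hq) (mul_ne_zero hp0 hq0)).const_mul _
    have hL : HasDerivAt (fun t => (lineEq (p t) (q t) z : ℂ))
        (Complex.I / 2 * ((q t₀ - p t₀) / (p t₀ * q t₀)) *
          ((p' * q t₀ + p t₀ * q') * conj z - p' - q')) t₀ := by
      -- The line equation is a nonvanishing factor times the chord equation; the latter is zero at
      -- t₀, so the derivative of the factor drops out.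
      have := hK.hasDerivAt.mul hC
      rw [show z + p t₀ * q t₀ * conj z - p t₀ - q t₀ = 0 by rw [hl']; ring, mul_zero,
        zero_add] at this
      refine this.congr_of_eventuallyEq ?_
      filter_upwards [hc] with t ht
      exact lineEq_eq (h.norm_eq_one_of_map_eq_exp ht.2.1) (h.norm_eq_one_of_map_eq_exp ht.2.2)
    have hk0 : Complex.I / 2 * ((q t₀ - p t₀) / (p t₀ * q t₀)) ≠ 0 := by
      refine mul_ne_zero (by simp) (div_ne_zero (sub_ne_zero.2 hc0.1.symm) (mul_ne_zero hp0 hq0))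
    constructor
    · intro hd
      have := hL.unique hd.ofReal_comp
      rw [Complex.ofReal_zero, mul_eq_zero, or_iff_right hk0] at this
      linear_combination this
    · intro e
      rw [show (p' * q t₀ + p t₀ * q') * conj z - p' - q' = 0 by rw [e]; ring, mul_zero] at hL
      simpa using! Complex.reCLM.hasFDerivAt.comp_hasDerivAt t₀ hL
  ext z
  constructor
  · rintro ⟨t₀, p, q, hp, hq, hc, hl, hd⟩
    have hc0 := hc.self_of_nhds
    have hpn := h.norm_eq_one_of_map_eq_exp hc0.2.1
    have hqn := h.norm_eq_one_of_map_eq_exp hc0.2.2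
    refine ⟨p t₀, q t₀, ⟨hpn, hqn, hc0.1, hc0.2.1.trans hc0.2.2.symm⟩, ?_⟩
    exact h.eq_envPoint_of_speed hpn hqn ((key t₀ p q z (hp.differentiableAt (by simp))
      (hq.differentiableAt (by simp)) hc hl).1 hd)
  · rintro ⟨p, q, hpq, rfl⟩
    obtain ⟨t₀, ht⟩ := exists_exp_of_norm_eq_one ((h.norm_eq_one_iff p).2 hpq.norm_left)
    obtain ⟨P, hP0, hP⟩ := h.exists_branch hpq.norm_left ht
    obtain ⟨Q, hQ0, hQ⟩ := h.exists_branch hpq.norm_right (hpq.map_eq ▸ ht)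
    have hc : ∀ᶠ t : ℝ in 𝓝 t₀, (P t, Q t) ∈ chords B (Complex.exp (t * Complex.I)) := by
      have : ∀ᶠ t : ℝ in 𝓝 t₀, P t ≠ Q t :=
        (hP.analyticAt.continuousAt.ne_iff_eventually_ne hQ.analyticAt.continuousAt).1
          (by rw [hP0, hQ0]; exact hpq.ne)
      filter_upwards [this, hP.map_eq, hQ.map_eq] with t h1 h2 h3 using ⟨h1, h2, h3⟩
    have hl : lineEq (P t₀) (Q t₀) (envPoint B p q) = 0 := by
      rw [hP0, hQ0, lineEq_eq_zero_iff hpq.norm_left hpq.norm_right hpq.ne]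
      exact h.envPoint_chord hpq.norm_left hpq.norm_right
    refine ⟨t₀, P, Q, hP.analyticAt.contDiffAt, hQ.analyticAt.contDiffAt, hc, hl, ?_⟩
    rw [key t₀ P Q _ hP.analyticAt.differentiableAt hQ.analyticAt.differentiableAt hc hl, hP0, hQ0]
    exact h.envPoint_speed hpq.norm_left hpq.norm_right

/-! ### Local branches of the envelope -/

/-- The second intersection with the unit circle of the line through `a` and the point `p` of the
unit circle. -/
noncomputable def opposite (a p : ℂ) : ℂ :=
  (a - p) / (1 - conj a * p)

/-- All lines through `a` join two points with the same image under `B`. -/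
def IsCentral (B : ℂ → ℂ) (a : ℂ) : Prop :=
  ∀ p, ‖p‖ = 1 → B (opposite a p) = B p

theorem one_sub_conj_mul_ne_zero {a p : ℂ} (ha : ‖a‖ < 1) (hp : ‖p‖ = 1) :
    1 - conj a * p ≠ 0 := by
  intro h0
  have : ‖conj a * p‖ = 1 := by rw [← sub_eq_zero.1 h0, norm_one]
  rw [norm_mul, hp, mul_one, RCLike.norm_conj] at this
  exact ha.ne this

theorem eq_opposite_iff {a p q : ℂ} (ha : ‖a‖ < 1) (hp : ‖p‖ = 1) :
    q = opposite a p ↔ a + p * q * conj a = p + q := by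
  have := one_sub_conj_mul_ne_zero ha hp
  rw [opposite, eq_div_iff this]
  constructor <;> intro e <;> linear_combination -e

theorem norm_opposite {a p : ℂ} (ha : ‖a‖ < 1) (hp : ‖p‖ = 1) : ‖opposite a p‖ = 1 := by
  have h0 := one_sub_conj_mul_ne_zero ha hp
  have hp0 := ne_zero_of_norm_eq_one hp
  have e : a - p = - p * conj (1 - conj a * p) := by
    simp only [map_sub, map_one, map_mul, Complex.conj_conj, conj_eq_inv_of_norm_eq_one hp]
    field_simp
    ring
  rw [opposite, e, norm_div, norm_mul, RCLike.norm_conj, norm_neg, hp, one_mul,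
    div_self (norm_ne_zero_iff.2 h0)]

theorem opposite_ne {a p : ℂ} (ha : ‖a‖ < 1) (hp : ‖p‖ = 1) : p ≠ opposite a p := by
  intro e
  rw [eq_opposite_iff ha hp] at e
  have h1 : ‖a + p * p * conj a‖ = 2 := by
    rw [e, ← two_mul, norm_mul, hp]
    simp
  have h2 := norm_add_le a (p * p * conj a)
  rw [norm_mul, norm_mul, hp, RCLike.norm_conj] at h2
  linarith

theorem analyticAt_opposite {a p : ℂ} (ha : ‖a‖ < 1) (hp : ‖p‖ = 1) :
    AnalyticAt ℂ (opposite a) p := by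
  have h0 := one_sub_conj_mul_ne_zero ha hp
  unfold opposite
  fun_prop (disch := assumption)

theorem IsCentral.isChord {B : ℂ → ℂ} {a p : ℂ} (hc : IsCentral B a) (ha : ‖a‖ < 1)
    (hp : ‖p‖ = 1) : IsChord B p (opposite a p) :=
  ⟨hp, norm_opposite ha hp, opposite_ne ha hp, (hc p hp).symm⟩

/-- A local branch of the envelope. -/
structure IsChordBranch (B : ℂ → ℂ) (P Q : ℝ → ℂ) (t₀ : ℝ) : Prop where
  left : IsBranch B P t₀
  right : IsBranch B Q t₀
  ne : P t₀ ≠ Q t₀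

namespace CircleCover

variable {B : ℂ → ℂ} (h : CircleCover B)
include h

theorem exists_chordBranch {p q : ℂ} (hpq : IsChord B p q) :
    ∃ (t₀ : ℝ) (P Q : ℝ → ℂ), P t₀ = p ∧ Q t₀ = q ∧ IsChordBranch B P Q t₀ := by
  obtain ⟨t₀, ht⟩ := exists_exp_of_norm_eq_one ((h.norm_eq_one_iff p).2 hpq.norm_left)
  obtain ⟨P, hP0, hP⟩ := h.exists_branch hpq.norm_left ht
  obtain ⟨Q, hQ0, hQ⟩ := h.exists_branch hpq.norm_right (hpq.map_eq ▸ ht)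
  exact ⟨t₀, P, Q, hP0, hQ0, hP, hQ, by rw [hP0, hQ0]; exact hpq.ne⟩

theorem analyticAt_weight {z : ℂ} (hz : ‖z‖ = 1) : AnalyticAt ℂ (weight B) z := by
  have h1 := h.analyticAt z hz
  have h0 : B z ≠ 0 := ne_zero_of_norm_eq_one ((h.norm_eq_one_iff z).2 hz)
  exact (analyticAt_id.mul h1.deriv).div h1 h0

theorem weight_add_ne_zero {p q : ℂ} (hp : ‖p‖ = 1) (hq : ‖q‖ = 1) :
    weight B p + weight B q ≠ 0 := by
  obtain ⟨r, hr, er⟩ := h.weight_pos p hp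
  obtain ⟨s, hs, es⟩ := h.weight_pos q hq
  rw [er, es]
  exact_mod_cast (add_pos hr hs).ne'

theorem continuousAt_envPoint {p q : ℂ} (hp : ‖p‖ = 1) (hq : ‖q‖ = 1) :
    ContinuousAt (fun x : ℂ × ℂ => envPoint B x.1 x.2) (p, q) := by
  have h1 : ContinuousAt (fun x : ℂ × ℂ => weight B x.1) (p, q) :=
    ContinuousAt.comp_of_eq (h.analyticAt_weight hp).continuousAt continuousAt_fst rfl
  have h2 : ContinuousAt (fun x : ℂ × ℂ => weight B x.2) (p, q) :=
    ContinuousAt.comp_of_eq (h.analyticAt_weight hq).continuousAt continuousAt_snd rfl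
  exact ((h1.mul continuousAt_fst).add (h2.mul continuousAt_snd)).div (h1.add h2)
    (h.weight_add_ne_zero hp hq)

end CircleCover

namespace IsBranch

variable {B : ℂ → ℂ} {P : ℝ → ℂ} {t₀ : ℝ}

theorem norm_eq_one (hP : IsBranch B P t₀) (h : CircleCover B) : ‖P t₀‖ = 1 :=
  h.norm_eq_one_of_map_eq_exp hP.map_eq.self_of_nhds

theorem eventually_hasDerivAt (hP : IsBranch B P t₀) (h : CircleCover B) :
    ∀ᶠ t in 𝓝 t₀, HasDerivAt P (Complex.I * P t / weight B (P t)) t := by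
  filter_upwards [hP.analyticAt.eventually_analyticAt, hP.map_eq.eventually_nhds] with t h1 h2
  exact h.hasDerivAt_of_map_eq h1.differentiableAt h2

theorem eventually_exists (hP : IsBranch B P t₀) (h : CircleCover B) {V : Set ℝ} (hV : V ∈ 𝓝 t₀) :
    ∀ᶠ z in 𝓝 (P t₀), ‖z‖ = 1 →
      ∃ t ∈ V, B z = Complex.exp (t * Complex.I) ∧ z = P t := by
  obtain ⟨U, hU, W, hW, hUW⟩ := mem_nhds_prod_iff.1 hP.unique
  filter_upwards [hU, h.eventually_exists_angle (hP.norm_eq_one h) hP.map_eq.self_of_nhds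
    (inter_mem hV hW)] with z hz hz' hn
  obtain ⟨t, ht, e⟩ := hz' hn
  exact ⟨t, ht.1, e, @hUW (z, t) ⟨hz, ht.2⟩ e⟩

end IsBranch

namespace IsChordBranch

variable {B : ℂ → ℂ} {P Q : ℝ → ℂ} {t₀ : ℝ} (hPQ : IsChordBranch B P Q t₀) (h : CircleCover B)
include hPQ h

theorem eventually_isChord : ∀ᶠ t in 𝓝 t₀, IsChord B (P t) (Q t) := by
  filter_upwards [hPQ.left.map_eq, hPQ.right.map_eq,
    (hPQ.left.analyticAt.continuousAt.ne_iff_eventually_ne hPQ.right.analyticAt.continuousAt).1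
      hPQ.ne] with t h1 h2 h3
  exact ⟨h.norm_eq_one_of_map_eq_exp h1, h.norm_eq_one_of_map_eq_exp h2, h3, h1.trans h2.symm⟩

theorem analyticAt_envPoint : AnalyticAt ℝ (fun t => envPoint B (P t) (Q t)) t₀ := by
  have hp := hPQ.left.norm_eq_one h
  have hq := hPQ.right.norm_eq_one h
  have h1 : AnalyticAt ℝ (fun t => weight B (P t)) t₀ :=
    ((h.analyticAt_weight hp).restrictScalars (𝕜 := ℝ)).comp_of_eq hPQ.left.analyticAt rfl
  have h2 : AnalyticAt ℝ (fun t => weight B (Q t)) t₀ :=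
    ((h.analyticAt_weight hq).restrictScalars (𝕜 := ℝ)).comp_of_eq hPQ.right.analyticAt rfl
  exact ((h1.mul hPQ.left.analyticAt).add (h2.mul hPQ.right.analyticAt)).div (h1.add h2)
    (h.weight_add_ne_zero hp hq)

theorem eventually_exists {V : Set ℝ} (hV : V ∈ 𝓝 t₀) :
    ∀ᶠ x in 𝓝 (P t₀, Q t₀), IsChord B x.1 x.2 → ∃ t ∈ V, x.1 = P t ∧ x.2 = Q t := by
  obtain ⟨U, hU, W, hW, hUW⟩ := mem_nhds_prod_iff.1 hPQ.right.unique
  have h1 : Tendsto (Prod.fst : ℂ × ℂ → ℂ) (𝓝 (P t₀, Q t₀)) (𝓝 (P t₀)) := continuousAt_fst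
  have h2 : Tendsto (Prod.snd : ℂ × ℂ → ℂ) (𝓝 (P t₀, Q t₀)) (𝓝 (Q t₀)) := continuousAt_snd
  filter_upwards [h1.eventually (hPQ.left.eventually_exists h (inter_mem hV hW)),
    h2.eventually hU] with x hx hx2 hc
  obtain ⟨t, ht, e, e'⟩ := hx hc.norm_left
  exact ⟨t, ht.1, e', @hUW (x.2, t) ⟨hx2, ht.2⟩ (hc.map_eq ▸ e)⟩

/-- The velocity of the envelope has the direction of the chord. -/
theorem eventually_deriv_direction :
    ∀ᶠ t in 𝓝 t₀, deriv (fun t => envPoint B (P t) (Q t)) t +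
      P t * Q t * conj (deriv (fun t => envPoint B (P t) (Q t)) t) = 0 := by
  filter_upwards [(hPQ.analyticAt_envPoint h).eventually_analyticAt,
    hPQ.left.eventually_hasDerivAt h, hPQ.right.eventually_hasDerivAt h,
    (hPQ.eventually_isChord h).eventually_nhds] with t hf hP hQ hc
  have hf' := hf.differentiableAt.hasDerivAt
  set f := fun t => envPoint B (P t) (Q t) with hfdef
  have hconj : HasDerivAt (fun t => conj (f t)) (conj (deriv f t)) t := by
    simpa using! Complex.conjCLE.toContinuousLinearMap.hasFDerivAt.comp_hasDerivAt t hf'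
  have hd := (hf'.add ((hP.mul hQ).mul hconj)).sub (hP.add hQ)
  have h0 : HasDerivAt (fun _ : ℝ => (0 : ℂ)) 0 t := hasDerivAt_const t 0
  have hz := h0.congr_of_eventuallyEq
    (f₁ := f + (P * Q) * (fun t => conj (f t)) - (P + Q)) (by
      filter_upwards [hc] with s hs
      simp only [Pi.sub_apply, Pi.add_apply, Pi.mul_apply]
      rw [sub_eq_zero]
      exact h.envPoint_chord hs.norm_left hs.norm_right)
  have e := hd.unique hz
  have hcc := hc.self_of_nhds
  have hsp := h.envPoint_speed hcc.norm_left hcc.norm_right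
  simp only [Pi.mul_apply] at e
  linear_combination e - hsp

/-- Unless the branch of the envelope is locally constant, its secants converge to the chord. -/
theorem exists_direction (hne : ¬ ∀ᶠ t in 𝓝 t₀, envPoint B (P t) (Q t) = envPoint B (P t₀) (Q t₀)) :
    ∃ (n : ℕ) (g : ℝ → ℂ), ContinuousAt g t₀ ∧ g t₀ ≠ 0 ∧
      (∀ᶠ t in 𝓝 t₀, envPoint B (P t) (Q t) - envPoint B (P t₀) (Q t₀) = (t - t₀) ^ n • g t) ∧
      g t₀ + P t₀ * Q t₀ * conj (g t₀) = 0 := by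
  have hf := hPQ.analyticAt_envPoint h
  have hdir := hPQ.eventually_deriv_direction h
  set f := fun t => envPoint B (P t) (Q t) with hfdef
  have hfs : AnalyticAt ℝ (fun t => f t - f t₀) t₀ := hf.sub analyticAt_const
  have hne' : ¬ ∀ᶠ t in 𝓝 t₀, (fun t => f t - f t₀) t = 0 := by
    simpa only [sub_eq_zero] using hne
  obtain ⟨n, g, hg, hg0, hfg⟩ := hfs.exists_eventuallyEq_pow_smul_nonzero_iff.2 hne'
  refine ⟨n, g, hg.continuousAt, hg0, hfg, ?_⟩
  have hn : n ≠ 0 := by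
    rintro rfl
    have := hfg.self_of_nhds
    simp only [sub_self, pow_zero, one_smul] at this
    exact hg0 this.symm
  obtain ⟨m, rfl⟩ := Nat.exists_eq_succ_of_ne_zero hn
  -- k is the derivative of (t - t₀)^(m+1) • g divided by (t - t₀)^m. That real power cancels from
  -- the direction equation for t ≠ t₀, and continuity carries the equation to k t₀ = (m+1) g t₀.
  set k : ℝ → ℂ := fun t => ((m + 1 : ℕ) : ℝ) • g t + (t - t₀) • deriv g t with hk
  have hderiv : ∀ᶠ t in 𝓝 t₀, deriv f t = (t - t₀) ^ m • k t := by
    filter_upwards [hfg.eventually_nhds, hg.eventually_analyticAt] with t h1 h2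
    have h3 : HasDerivAt (fun t => (t - t₀) ^ (m + 1) • g t) _ t :=
      (((hasDerivAt_id t).sub_const t₀).pow (m + 1)).smul h2.differentiableAt.hasDerivAt
    have h4 := h3.congr_of_eventuallyEq h1
    have h5 := h4.deriv
    rw [deriv_sub_const] at h5
    rw [h5]
    simp only [hk, id, smul_add, smul_smul, Nat.add_sub_cancel, mul_one, Pi.pow_apply]
    rw [add_comm, pow_succ]
    congr 2
    ring
  have hkd : ∀ᶠ t in 𝓝[≠] t₀, k t + P t * Q t * conj (k t) = 0 := by
    filter_upwards [nhdsWithin_le_nhds hderiv, nhdsWithin_le_nhds hdir, self_mem_nhdsWithin]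
      with t h1 h2 h3
    rw [h1] at h2
    have h4 : ((t - t₀ : ℝ) : ℂ) ^ m ≠ 0 := by
      exact_mod_cast pow_ne_zero m (sub_ne_zero.2 h3)
    refine mul_left_cancel₀ h4 ?_
    simp only [Complex.real_smul, map_mul, Complex.conj_ofReal, Complex.ofReal_pow, map_pow] at h2
    linear_combination h2
  have hk1 : ContinuousAt (fun t => ((m + 1 : ℕ) : ℝ) • g t) t₀ :=
    hg.continuousAt.const_smul ((m + 1 : ℕ) : ℝ)
  have hk2 : ContinuousAt (fun t => (t - t₀) • deriv g t) t₀ :=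
    (continuousAt_id.sub continuousAt_const).smul hg.deriv.continuousAt
  have hkc : ContinuousAt k t₀ := hk1.add hk2
  have hcont : ContinuousAt (fun t => k t + P t * Q t * conj (k t)) t₀ :=
    hkc.add ((hPQ.left.analyticAt.continuousAt.mul hPQ.right.analyticAt.continuousAt).mul
      (Complex.continuous_conj.continuousAt.comp_of_eq hkc rfl))
  have h0 : k t₀ + P t₀ * Q t₀ * conj (k t₀) = 0 :=
    tendsto_nhds_unique (hcont.tendsto.mono_left nhdsWithin_le_nhds)
      (tendsto_const_nhds.congr' (hkd.mono fun t ht => ht.symm))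
  have hk0 : k t₀ = ((m + 1 : ℕ) : ℂ) * g t₀ := by simp [hk]
  rw [hk0, map_mul, Complex.conj_natCast] at h0
  have hm : ((m + 1 : ℕ) : ℂ) ≠ 0 := by exact_mod_cast Nat.succ_ne_zero m
  refine mul_left_cancel₀ hm ?_
  linear_combination h0

/-- Uniqueness of branches forces Q = `opposite a` ∘ P, so all nearby chords pass through a; then a
solves their differentiated equations too, and is their envelope point. -/
theorem eventually_eq_of_isCentral (ha : ‖envPoint B (P t₀) (Q t₀)‖ < 1)
    (hc : IsCentral B (envPoint B (P t₀) (Q t₀))) :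
    ∀ᶠ t in 𝓝 t₀, envPoint B (P t) (Q t) = envPoint B (P t₀) (Q t₀) := by
  have hp := hPQ.left.norm_eq_one h
  have hq := hPQ.right.norm_eq_one h
  have hchord := h.envPoint_chord hp hq
  set a := envPoint B (P t₀) (Q t₀) with hadef
  have hq0 : Q t₀ = opposite a (P t₀) := (eq_opposite_iff ha hp).2 hchord
  have hcont : ContinuousAt (fun t => (opposite a (P t), t)) t₀ := by
    refine ContinuousAt.prodMk ?_ continuousAt_id
    exact ContinuousAt.comp_of_eq (analyticAt_opposite ha hp).continuousAt
      hPQ.left.analyticAt.continuousAt rfl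
  have huniq := hPQ.right.unique
  rw [hq0] at huniq
  have hop : ∀ᶠ t in 𝓝 t₀, Q t = opposite a (P t) := by
    filter_upwards [hcont.eventually huniq, hPQ.left.map_eq] with t h1 h2
    exact (h1 ((hc _ (h.norm_eq_one_of_map_eq_exp h2)).trans h2)).symm
  have hline : ∀ᶠ t in 𝓝 t₀, a + P t * Q t * conj a = P t + Q t := by
    filter_upwards [hop, hPQ.left.map_eq] with t h1 h2
    exact (eq_opposite_iff ha (h.norm_eq_one_of_map_eq_exp h2)).1 h1
  filter_upwards [hline.eventually_nhds, hPQ.left.eventually_hasDerivAt h,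
    hPQ.right.eventually_hasDerivAt h, hPQ.eventually_isChord h] with t h1 h2 h3 h4
  refine (h.eq_envPoint_of_speed h4.norm_left h4.norm_right ?_).symm
  have h5 := ((h2.mul h3).mul_const (conj a)).const_add a
  have h6 := (h2.add h3).congr_of_eventuallyEq
    (f₁ := fun t => a + (P * Q) t * conj a) (by filter_upwards [h1] with s hs; exact hs)
  exact h5.unique h6

/-- Constancy gives B (`opposite a z`) = B z on an arc of the circle; with z = e^{is} both sides are
real analytic in s, so the identity theorem extends this to the whole circle. -/
theorem isCentral_of_eventually_eq (ha : ‖envPoint B (P t₀) (Q t₀)‖ < 1)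
    (hc : ∀ᶠ t in 𝓝 t₀, envPoint B (P t) (Q t) = envPoint B (P t₀) (Q t₀)) :
    IsCentral B (envPoint B (P t₀) (Q t₀)) := by
  have hp := hPQ.left.norm_eq_one h
  set a := envPoint B (P t₀) (Q t₀) with hadef
  have hV : {t | B (opposite a (P t)) = B (P t)} ∈ 𝓝 t₀ := by
    filter_upwards [hc, hPQ.eventually_isChord h] with t h1 h2
    have : Q t = opposite a (P t) := by
      rw [eq_opposite_iff ha h2.norm_left, ← h1]
      exact h.envPoint_chord h2.norm_left h2.norm_right
    rw [← this, h2.map_eq]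
  have hnear : ∀ᶠ z in 𝓝 (P t₀), ‖z‖ = 1 → B (opposite a z) = B z := by
    filter_upwards [hPQ.left.eventually_exists h hV] with z hz hn
    obtain ⟨t, ht, -, rfl⟩ := hz hn
    exact ht
  obtain ⟨s₀, hs₀⟩ := exists_exp_of_norm_eq_one hp
  set F : ℝ → ℂ := fun s => B (opposite a (Complex.exp (s * Complex.I))) -
    B (Complex.exp (s * Complex.I)) with hF
  have hFa : AnalyticOnNhd ℝ F Set.univ := by
    intro s _
    have hn := Complex.norm_exp_ofReal_mul_I s
    have h1 : AnalyticAt ℂ (fun z => B (opposite a z) - B z) (Complex.exp (s * Complex.I)) :=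
      ((h.analyticAt _ (norm_opposite ha hn)).comp_of_eq (analyticAt_opposite ha hn) rfl).sub
        (h.analyticAt _ hn)
    exact (h1.restrictScalars (𝕜 := ℝ)).comp_of_eq (analyticAt_exp_mul_I s) rfl
  have hF0 : F =ᶠ[𝓝 s₀] 0 := by
    rw [hs₀] at hnear
    filter_upwards [(analyticAt_exp_mul_I s₀).continuousAt.eventually hnear] with s hs
    simp [hF, hs (Complex.norm_exp_ofReal_mul_I s)]
  intro z hz
  obtain ⟨s, rfl⟩ := exists_exp_of_norm_eq_one hz
  exact sub_eq_zero.1 (hFa.eqOn_zero_of_preconnected_of_eventuallyEq_zero isPreconnected_univ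
    (Set.mem_univ s₀) hF0 (Set.mem_univ s))

end IsChordBranch

/-! ### Lines and limits in the projective plane -/

/-- The linear part of the equation of the line with coordinates `l`. -/
def linForm (l : Fin 3 → ℝ) (u : ℂ) : ℝ :=
  l 0 * u.re + l 1 * u.im

theorem linForm_add (l : Fin 3 → ℝ) (u v : ℂ) : linForm l (u + v) = linForm l u + linForm l v := by
  simp only [linForm, Complex.add_re, Complex.add_im]
  ring

theorem linForm_sub (l : Fin 3 → ℝ) (u v : ℂ) : linForm l (u - v) = linForm l u - linForm l v := by
  simp only [linForm, Complex.sub_re, Complex.sub_im]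
  ring

theorem linForm_real_mul (l : Fin 3 → ℝ) (x : ℝ) (u : ℂ) :
    linForm l (x * u) = x * linForm l u := by
  simp only [linForm, Complex.re_ofReal_mul, Complex.im_ofReal_mul]
  ring

theorem orthogonal_mk_toProj {l : Fin 3 → ℝ} (hl : l ≠ 0) (z : ℂ) :
    Projectivization.orthogonal (Projectivization.mk ℝ l hl) (toProj z) ↔
      linForm l z + l 2 = 0 := by
  rw [toProj, Projectivization.orthogonal_mk hl (affine_ne_zero z)]
  simp [linForm, dotProduct, Fin.sum_univ_three]

theorem exists_eq_mk (L : RealPlane) :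
    ∃ (l : Fin 3 → ℝ) (hl : l ≠ 0), L = Projectivization.mk ℝ l hl :=
  ⟨L.rep, L.rep_nonzero, L.mk_rep.symm⟩

theorem mk_eq_toProj_iff {q : Fin 3 → ℝ} (hq : q ≠ 0) (z : ℂ) :
    Projectivization.mk ℝ q hq = toProj z ↔ q 0 = q 2 * z.re ∧ q 1 = q 2 * z.im := by
  rw [toProj, Projectivization.mk_eq_mk_iff']
  constructor
  · rintro ⟨c, rfl⟩
    simp
  · rintro ⟨h0, h1⟩
    refine ⟨q 2, ?_⟩
    ext i
    fin_cases i <;> simp [h0, h1]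

theorem toProj_injective : Function.Injective toProj := by
  intro z w e
  have := (mk_eq_toProj_iff (affine_ne_zero z) w).1 e
  simp at this
  exact Complex.ext this.1 this.2

theorem projTendsto_toProj {z : ℕ → ℂ} {a : ℂ} (hz : Tendsto z atTop (𝓝 a)) :
    ProjTendsto (fun n => toProj (z n)) (toProj a) := by
  refine ⟨fun n => ![(z n).re, (z n).im, 1], ![a.re, a.im, 1], fun n => affine_ne_zero _,
    affine_ne_zero _, fun n => rfl, rfl, ?_⟩
  rw [tendsto_pi_nhds]
  intro i
  fin_cases i
  · exact (Complex.continuous_re.tendsto a).comp hz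
  · exact (Complex.continuous_im.tendsto a).comp hz
  · exact tendsto_const_nhds

theorem ProjTendsto.comp {P : ℕ → RealPlane} {Q : RealPlane} (h : ProjTendsto P Q) {φ : ℕ → ℕ}
    (hφ : Tendsto φ atTop atTop) : ProjTendsto (P ∘ φ) Q := by
  obtain ⟨p, q, hp, hq, h1, h2, h3⟩ := h
  exact ⟨p ∘ φ, q, fun n => hp _, hq, fun n => h1 _, h2, h3.comp hφ⟩

/-- The representatives need not have last coordinate 1, so the limit is taken in the homogeneous
relations. -/
theorem ProjTendsto.eq_toProj {z : ℕ → ℂ} {Q : RealPlane} {a : ℂ}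
    (h : ProjTendsto (fun n => toProj (z n)) Q) (hz : Tendsto z atTop (𝓝 a)) : Q = toProj a := by
  obtain ⟨p, q, hp, hq, h1, rfl, h3⟩ := h
  rw [mk_eq_toProj_iff]
  have h4 := tendsto_pi_nhds.1 h3
  have h5 := fun n => (mk_eq_toProj_iff (hp n) _).1 (h1 n)
  constructor
  · refine tendsto_nhds_unique (h4 0) ?_
    refine ((h4 2).mul ((Complex.continuous_re.tendsto a).comp hz)).congr fun n => ?_
    exact (h5 n).1.symm
  · refine tendsto_nhds_unique (h4 1) ?_
    refine ((h4 2).mul ((Complex.continuous_im.tendsto a).comp hz)).congr fun n => ?_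
    exact (h5 n).2.symm

theorem ProjTendsto.tendsto_toProj {z : ℕ → ℂ} {a : ℂ}
    (h : ProjTendsto (fun n => toProj (z n)) (toProj a)) : Tendsto z atTop (𝓝 a) := by
  obtain ⟨p, q, hp, hq, h1, h2, h3⟩ := h
  have h4 := tendsto_pi_nhds.1 h3
  have h5 := fun n => (mk_eq_toProj_iff (hp n) _).1 (h1 n)
  have h6 := (mk_eq_toProj_iff hq a).1 h2
  have hq2 : q 2 ≠ 0 := by
    intro e
    apply hq
    ext i
    fin_cases i <;> simp [h6, e]
  have hp2 : ∀ n, p n 2 ≠ 0 := by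
    intro n e
    apply hp n
    ext i
    fin_cases i <;> simp [h5, e]
  have hre : Tendsto (fun n => (z n).re) atTop (𝓝 a.re) := by
    have := (h4 0).div (h4 2) hq2
    rw [h6.1, mul_div_cancel_left₀ _ hq2] at this
    refine this.congr fun n => ?_
    rw [Pi.div_apply, (h5 n).1, mul_div_cancel_left₀ _ (hp2 n)]
  have him : Tendsto (fun n => (z n).im) atTop (𝓝 a.im) := by
    have := (h4 1).div (h4 2) hq2
    rw [h6.2, mul_div_cancel_left₀ _ hq2] at this
    refine this.congr fun n => ?_
    rw [Pi.div_apply, (h5 n).2, mul_div_cancel_left₀ _ (hp2 n)]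
  have := (Complex.equivRealProdCLM.symm.continuous.tendsto (a.re, a.im)).comp
    (hre.prodMk_nhds him)
  simpa [Function.comp_def, Complex.equivRealProdCLM_symm_apply] using! this

theorem homogenization_of_isCompact {C : Set ℂ} (hC : IsCompact C) :
    homogenization C = toProj '' C := by
  ext Q
  constructor
  · rintro ⟨z, hz, hQ⟩
    obtain ⟨a, ha, φ, hφ, hlim⟩ := hC.tendsto_subseq hz
    exact ⟨a, ha, ((hQ.comp hφ.tendsto_atTop).eq_toProj hlim).symm⟩
  · rintro ⟨a, ha, rfl⟩
    exact ⟨fun _ => a, fun _ => ha, projTendsto_toProj tendsto_const_nhds⟩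

/-- The coordinates of the line through `a` with direction `g`. -/
def dirLine (a g : ℂ) : Fin 3 → ℝ :=
  ![g.im, -g.re, g.re * a.im - g.im * a.re]

theorem dirLine_ne_zero {g : ℂ} (a : ℂ) (hg : g ≠ 0) : dirLine a g ≠ 0 := by
  intro e
  have h0 := congrFun e 0
  have h1 := congrFun e 1
  simp [dirLine] at h0 h1
  exact hg (Complex.ext h1 h0)

theorem mk_eq_mk_dirLine {l : Fin 3 → ℝ} (hl : l ≠ 0) {a g : ℂ} (hg : g ≠ 0)
    (ha : linForm l a + l 2 = 0) (hlg : linForm l g = 0) :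
    Projectivization.mk ℝ l hl = Projectivization.mk ℝ (dirLine a g) (dirLine_ne_zero a hg) := by
  rw [Projectivization.mk_eq_mk_iff']
  have hN : g.re * g.re + g.im * g.im ≠ 0 := by
    rw [← Complex.normSq_apply]
    exact (Complex.normSq_pos.2 hg).ne'
  simp only [linForm] at ha hlg
  -- The scalar is the component of (l 0, l 1) along the normal (Im g, -Re g) of the direction g.
  have e0 : (l 0 * g.im - l 1 * g.re) / (g.re * g.re + g.im * g.im) * g.im = l 0 := by
    rw [div_mul_eq_mul_div, div_eq_iff hN]
    linear_combination -g.re * hlg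
  have e1 : (l 0 * g.im - l 1 * g.re) / (g.re * g.re + g.im * g.im) * g.re = - l 1 := by
    rw [div_mul_eq_mul_div, div_eq_iff hN]
    linear_combination g.im * hlg
  refine ⟨(l 0 * g.im - l 1 * g.re) / (g.re * g.re + g.im * g.im), ?_⟩
  ext i
  fin_cases i
  · simpa [dirLine] using e0
  · simpa [dirLine] using (neg_eq_iff_eq_neg.2 e1)
  · simp only [dirLine, Fin.reduceFinMk, Pi.smul_apply, Matrix.cons_val, smul_eq_mul]
    linear_combination a.im * e1 - a.re * e0 - ha

theorem orthogonal_dirLine {a g : ℂ} (hg : g ≠ 0) (x : ℝ) :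
    Projectivization.orthogonal (Projectivization.mk ℝ (dirLine a g) (dirLine_ne_zero a hg))
      (toProj (a + x • g)) := by
  rw [orthogonal_mk_toProj]
  simp [dirLine, linForm]
  ring

theorem projTendsto_dirLine {a g : ℂ} {γ : ℕ → ℂ} (hg : g ≠ 0) (hγ : ∀ n, γ n ≠ 0)
    (h : Tendsto γ atTop (𝓝 g)) :
    ProjTendsto (fun n => Projectivization.mk ℝ (dirLine a (γ n)) (dirLine_ne_zero a (hγ n)))
      (Projectivization.mk ℝ (dirLine a g) (dirLine_ne_zero a hg)) := by
  refine ⟨_, _, _, _, fun n => rfl, rfl, ?_⟩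
  have hre := (Complex.continuous_re.tendsto g).comp h
  have him := (Complex.continuous_im.tendsto g).comp h
  rw [tendsto_pi_nhds]
  intro i
  fin_cases i
  · exact him
  · exact hre.neg
  · exact (hre.mul_const _).sub (him.mul_const _)

/-- Two solutions of u + m conj u = 0 have a quotient equal to its own conjugate, so the nonzero
ones span a real line. -/
theorem exists_real_mul_of_direction {m u g : ℂ} (hg : g ≠ 0) (hu : u + m * conj u = 0)
    (hgm : g + m * conj g = 0) : ∃ x : ℝ, u = x * g := by
  have hm : m ≠ 0 := by
    rintro rfl
    exact hg (by simpa using hgm)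
  have hg' : conj g ≠ 0 := by simpa using hg
  have : conj (u / g) = u / g := by
    rw [map_div₀, div_eq_div_iff hg' hg]
    refine mul_left_cancel₀ hm ?_
    linear_combination g * hu - u * hgm
  obtain ⟨x, hx⟩ := Complex.conj_eq_iff_real.1 this
  exact ⟨x, by rw [← hx, div_mul_cancel₀ _ hg]⟩

theorem linForm_eq_zero_of_direction {l : Fin 3 → ℝ} {m u g : ℂ} (hg : g ≠ 0)
    (hu : u + m * conj u = 0) (hgm : g + m * conj g = 0) (hl : linForm l g = 0) :
    linForm l u = 0 := by
  obtain ⟨x, rfl⟩ := exists_real_mul_of_direction hg hu hgm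
  rw [linForm_real_mul, hl, mul_zero]

theorem left_sub_direction {p q a : ℂ} (hp : ‖p‖ = 1) (h : a + p * q * conj a = p + q) :
    (p - a) + p * q * conj (p - a) = 0 := by
  have hp0 := ne_zero_of_norm_eq_one hp
  rw [map_sub, conj_eq_inv_of_norm_eq_one hp]
  field_simp
  linear_combination -h

theorem right_sub_direction {p q a : ℂ} (hq : ‖q‖ = 1) (h : a + p * q * conj a = p + q) :
    (q - a) + p * q * conj (q - a) = 0 := by
  rw [mul_comm p q] at h ⊢
  exact left_sub_direction hq (h.trans (add_comm p q))

/-- Intermediate values of the norm along the line, from a to a point at distance 2 from a, which is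
outside the disc. -/
theorem exists_norm_eq_one_of_line {l : Fin 3 → ℝ} (hl : l ≠ 0) {a : ℂ} (ha : ‖a‖ < 1)
    (hla : linForm l a + l 2 = 0) : ∃ p : ℂ, ‖p‖ = 1 ∧ linForm l p + l 2 = 0 := by
  set g : ℂ := ⟨-l 1, l 0⟩ with hg
  have hg0 : g ≠ 0 := by
    intro e
    have h0 : l 0 = 0 := by simpa [hg] using congrArg Complex.im e
    have h1 : l 1 = 0 := by simpa [hg] using congrArg Complex.re e
    have h2 : l 2 = 0 := by simpa [linForm, h0, h1] using hla
    exact hl (by ext i; fin_cases i <;> assumption)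
  have hlg : linForm l g = 0 := by
    simp [linForm, hg]
    ring
  have hgn : 0 < ‖g‖ := norm_pos_iff.2 hg0
  have hc : ContinuousOn (fun x : ℝ => ‖a + x * g‖) (Set.Icc 0 (2 / ‖g‖)) := by fun_prop
  have h2 : 1 ≤ ‖a + (2 / ‖g‖ : ℝ) * g‖ := by
    have e : ‖((2 / ‖g‖ : ℝ) : ℂ) * g‖ = 2 := by
      rw [norm_mul, Complex.norm_real, Real.norm_of_nonneg (by positivity)]
      field_simp
    have := norm_sub_le (a + (2 / ‖g‖ : ℝ) * g) a
    rw [add_sub_cancel_left, e] at this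
    linarith
  obtain ⟨x, -, hx⟩ := intermediate_value_Icc (by positivity : (0 : ℝ) ≤ 2 / ‖g‖) hc
    ⟨by simpa using ha.le, h2⟩
  refine ⟨_, hx, ?_⟩
  rw [linForm_add, linForm_real_mul, hlg]
  linarith

/-! ### The dual of the interior curve -/

namespace CircleCover

variable {B : ℂ → ℂ} (h : CircleCover B)
include h

/-- The ends of the chords cannot merge in the limit, since B is injective near each point of the
circle. -/
theorem exists_subseq_isChord {x : ℕ → ℂ × ℂ} (hx : ∀ n, IsChord B (x n).1 (x n).2) :
    ∃ y : ℂ × ℂ, IsChord B y.1 y.2 ∧ ∃ φ : ℕ → ℕ, StrictMono φ ∧ Tendsto (x ∘ φ) atTop (𝓝 y) := by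
  have hK : IsCompact (Metric.sphere (0 : ℂ) 1 ×ˢ Metric.sphere (0 : ℂ) 1) :=
    (isCompact_sphere _ _).prod (isCompact_sphere _ _)
  obtain ⟨⟨p, q⟩, hy, φ, hφ, hlim⟩ := hK.tendsto_subseq (x := x) fun n => by
    simpa using ⟨(hx n).norm_left, (hx n).norm_right⟩
  have hp : ‖p‖ = 1 := by simpa using hy.1
  have hq : ‖q‖ = 1 := by simpa using hy.2
  have h1 : Tendsto (fun n => (x (φ n)).1) atTop (𝓝 p) := (continuous_fst.tendsto _).comp hlim
  have h2 : Tendsto (fun n => (x (φ n)).2) atTop (𝓝 q) := (continuous_snd.tendsto _).comp hlim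
  refine ⟨(p, q), ⟨hp, hq, ?_, ?_⟩, φ, hφ, hlim⟩
  · intro e
    obtain rfl : p = q := e
    obtain ⟨U, hU, hinj⟩ := h.exists_injOn hp
    obtain ⟨n, hn1, hn2⟩ := ((h1.eventually hU).and (h2.eventually hU)).exists
    exact (hx (φ n)).ne (hinj hn1 hn2 (hx (φ n)).map_eq)
  · refine tendsto_nhds_unique ((h.analyticAt p hp).continuousAt.tendsto.comp h1) ?_
    exact ((h.analyticAt q hq).continuousAt.tendsto.comp h2).congr fun n => (hx (φ n)).map_eq.symm

theorem exists_subseq_envPoint {z : ℕ → ℂ} (hz : ∀ n, z n ∈ interiorCurve B) :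
    ∃ (x : ℕ → ℂ × ℂ) (y : ℂ × ℂ) (φ : ℕ → ℕ), (∀ n, IsChord B (x n).1 (x n).2) ∧
      (∀ n, z n = envPoint B (x n).1 (x n).2) ∧ IsChord B y.1 y.2 ∧ StrictMono φ ∧
      Tendsto (x ∘ φ) atTop (𝓝 y) ∧ Tendsto (z ∘ φ) atTop (𝓝 (envPoint B y.1 y.2)) := by
  rw [interiorCurve_eq h] at hz
  choose p q hpq hz using hz
  obtain ⟨y, hy, φ, hφ, hlim⟩ := h.exists_subseq_isChord (x := fun n => (p n, q n)) hpq
  refine ⟨fun n => (p n, q n), y, φ, hpq, hz, hy, hφ, hlim, ?_⟩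
  have := (h.continuousAt_envPoint hy.norm_left hy.norm_right).tendsto.comp hlim
  exact this.congr fun n => (hz (φ n)).symm

theorem envPoint_mem_interiorCurve {p q : ℂ} (hpq : IsChord B p q) :
    envPoint B p q ∈ interiorCurve B := by
  rw [interiorCurve_eq h]
  exact ⟨p, q, hpq, rfl⟩

theorem isCompact_interiorCurve : IsCompact (interiorCurve B) := by
  refine IsSeqCompact.isCompact fun z hz => ?_
  obtain ⟨x, y, φ, -, -, hy, hφ, -, hlim⟩ := h.exists_subseq_envPoint hz
  exact ⟨_, h.envPoint_mem_interiorCurve hy, φ, hφ, hlim⟩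

/-- Points of the interior curve that converge to one of its points eventually lie, up to a
subsequence, on a single local branch. -/
theorem exists_branch_of_tendsto {z : ℕ → ℂ} {a : ℂ} (hz : ∀ n, z n ∈ interiorCurve B)
    (ha : Tendsto z atTop (𝓝 a)) :
    ∃ (t₀ : ℝ) (P Q : ℝ → ℂ), IsChordBranch B P Q t₀ ∧ a = envPoint B (P t₀) (Q t₀) ∧
      ∃ (φ : ℕ → ℕ) (s : ℕ → ℝ), Tendsto φ atTop atTop ∧ Tendsto s atTop (𝓝 t₀) ∧
        ∀ n, z (φ n) = envPoint B (P (s n)) (Q (s n)) := by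
  obtain ⟨x, y, φ, hx, hzx, hy, hφ, hxlim, hzlim⟩ := h.exists_subseq_envPoint hz
  have e : a = envPoint B y.1 y.2 :=
    tendsto_nhds_unique (ha.comp hφ.tendsto_atTop) hzlim
  obtain ⟨t₀, P, Q, hP, hQ, hPQ⟩ := h.exists_chordBranch hy
  have hy' : y = (P t₀, Q t₀) := by rw [hP, hQ]
  refine ⟨t₀, P, Q, hPQ, by rw [hP, hQ, e], ?_⟩
  have hfreq : ∀ k : ℕ, ∃ n, k ≤ n ∧ ∃ t ∈ Metric.ball t₀ (1 / (k + 1 : ℝ)),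
      z (φ n) = envPoint B (P t) (Q t) := by
    intro k
    have hev := hPQ.eventually_exists h (Metric.ball_mem_nhds t₀ (by positivity : 0 < 1 / (k + 1 : ℝ)))
    rw [← hy'] at hev
    obtain ⟨n, hn, hkn⟩ := ((hxlim.eventually hev).and (eventually_ge_atTop k)).exists
    obtain ⟨t, ht, e1, e2⟩ := hn (hx (φ n))
    refine ⟨n, hkn, t, ht, ?_⟩
    rw [hzx, ← e1, ← e2]
    rfl
  choose n hkn s hs hzs using hfreq
  refine ⟨φ ∘ n, s, hφ.tendsto_atTop.comp (tendsto_atTop_mono hkn tendsto_id), ?_, hzs⟩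
  rw [tendsto_iff_dist_tendsto_zero]
  exact squeeze_zero (fun k => dist_nonneg) (fun k => (hs k).le) tendsto_one_div_add_atTop_nhds_zero_nat

/-- Curve points converging to this one would run along some branch through it, and centrality makes
every such branch constant. -/
theorem isIsolatedIn_of_isCentral {p q : ℂ} (hpq : IsChord B p q)
    (hc : IsCentral B (envPoint B p q)) :
    IsIsolatedIn (toProj '' interiorCurve B) (toProj (envPoint B p q)) := by
  refine ⟨⟨_, h.envPoint_mem_interiorCurve hpq, rfl⟩, ?_⟩
  rintro ⟨R, hR, hlim⟩
  choose z hz hzR using fun n => (hR n).1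
  obtain rfl : (fun n => toProj (z n)) = R := funext hzR
  obtain ⟨t₀, P, Q, hPQ, ha, φ, s, -, hs, hzs⟩ := h.exists_branch_of_tendsto hz hlim.tendsto_toProj
  have hlt := h.norm_envPoint_lt_one hpq.norm_left hpq.norm_right hpq.ne
  rw [ha] at hc hlt
  obtain ⟨n, hn⟩ := (hs.eventually (hPQ.eventually_eq_of_isCentral h hlt hc)).exists
  exact (hR (φ n)).2 (congrArg toProj ((hzs n).trans (hn.trans ha.symm)))

theorem exists_seq_branch_ne {P Q : ℝ → ℂ} {t₀ : ℝ} (hPQ : IsChordBranch B P Q t₀)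
    (hne : ¬ ∀ᶠ t in 𝓝 t₀, envPoint B (P t) (Q t) = envPoint B (P t₀) (Q t₀)) {V : Set ℝ}
    (hV : V ∈ 𝓝 t₀) :
    ∃ s : ℕ → ℝ, Tendsto s atTop (𝓝 t₀) ∧ ∀ n, s n ∈ V ∧ IsChord B (P (s n)) (Q (s n)) ∧
      envPoint B (P (s n)) (Q (s n)) ≠ envPoint B (P t₀) (Q t₀) := by
  have hfr : ∃ᶠ t in 𝓝 t₀, envPoint B (P t) (Q t) ≠ envPoint B (P t₀) (Q t₀) :=
    not_eventually.1 hne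
  obtain ⟨s, hs, hs'⟩ := exists_seq_forall_of_frequently
    (hfr.and_eventually ((eventually_mem_set.2 hV).and (hPQ.eventually_isChord h)))
  exact ⟨s, hs, fun n => ⟨(hs' n).2.1, (hs' n).2.2, (hs' n).1⟩⟩

theorem isCentral_of_isIsolatedIn {P Q : ℝ → ℂ} {t₀ : ℝ} (hPQ : IsChordBranch B P Q t₀)
    (hi : IsIsolatedIn (toProj '' interiorCurve B) (toProj (envPoint B (P t₀) (Q t₀)))) :
    IsCentral B (envPoint B (P t₀) (Q t₀)) := by
  have hp := hPQ.left.norm_eq_one h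
  have hq := hPQ.right.norm_eq_one h
  refine hPQ.isCentral_of_eventually_eq h (h.norm_envPoint_lt_one hp hq hPQ.ne) ?_
  by_contra hne
  obtain ⟨s, hs, hs'⟩ := h.exists_seq_branch_ne hPQ hne univ_mem
  refine hi.2 ⟨fun n => toProj (envPoint B (P (s n)) (Q (s n))), fun n => ⟨⟨_,
    h.envPoint_mem_interiorCurve (hs' n).2.1, rfl⟩, toProj_injective.ne (hs' n).2.2⟩, ?_⟩
  exact projTendsto_toProj ((hPQ.analyticAt_envPoint h).continuousAt.tendsto.comp hs)

/-- A constant branch makes the envelope point isolated, where every line through it is tangent;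
otherwise the secants along the branch converge to the chord. -/
theorem mem_dualCurve_of_isChord {L : RealPlane} {p q : ℂ} (hpq : IsChord B p q)
    (hLp : Projectivization.orthogonal L (toProj p))
    (hLq : Projectivization.orthogonal L (toProj q)) :
    L ∈ dualCurve (toProj '' interiorCurve B) := by
  obtain ⟨l, hl, rfl⟩ := exists_eq_mk L
  rw [orthogonal_mk_toProj] at hLp hLq
  have hchord := h.envPoint_chord hpq.norm_left hpq.norm_right
  have hqp : q - p ≠ 0 := sub_ne_zero.2 hpq.ne.symm
  have hdir : (q - p) + p * q * conj (q - p) = 0 := by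
    have h1 := left_sub_direction hpq.norm_left hchord
    have h2 := right_sub_direction hpq.norm_right hchord
    rw [map_sub] at h1 h2 ⊢
    linear_combination h2 - h1
  have hl0 : linForm l (q - p) = 0 := by rw [linForm_sub]; linarith
  have hla : linForm l (envPoint B p q) + l 2 = 0 := by
    have := linForm_eq_zero_of_direction hqp (left_sub_direction hpq.norm_left hchord) hdir hl0
    rw [linForm_sub] at this
    linarith
  refine ⟨toProj (envPoint B p q), ⟨_, h.envPoint_mem_interiorCurve hpq, rfl⟩,
    (orthogonal_mk_toProj hl _).2 hla, ?_⟩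
  obtain ⟨t₀, P, Q, hP, hQ, hPQ⟩ := h.exists_chordBranch hpq
  by_cases hconst : ∀ᶠ t in 𝓝 t₀, envPoint B (P t) (Q t) = envPoint B (P t₀) (Q t₀)
  · left
    refine h.isIsolatedIn_of_isCentral hpq ?_
    have hlt := h.norm_envPoint_lt_one hpq.norm_left hpq.norm_right hpq.ne
    rw [← hP, ← hQ] at hlt ⊢
    exact hPQ.isCentral_of_eventually_eq h hlt hconst
  · right
    obtain ⟨k, g, hg, hg0, hfg, hgdir⟩ := hPQ.exists_direction h hconst
    have hgne : ∀ᶠ t in 𝓝 t₀, g t ≠ 0 := hg.eventually_ne hg0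
    obtain ⟨s, hs, hs'⟩ := h.exists_seq_branch_ne hPQ hconst (hfg.and hgne)
    rw [hP, hQ] at hgdir hs'
    have hgs : ∀ n, g (s n) ≠ 0 := fun n => (hs' n).1.2
    have hf := (hPQ.analyticAt_envPoint h).continuousAt.tendsto.comp hs
    simp only [hP, hQ] at hf hfg
    refine ⟨fun n => toProj (envPoint B (P (s n)) (Q (s n))),
      fun n => Projectivization.mk ℝ (dirLine (envPoint B p q) (g (s n)))
        (dirLine_ne_zero _ (hgs n)), fun n => ⟨⟨_, h.envPoint_mem_interiorCurve (hs' n).2.1, rfl⟩,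
        toProj_injective.ne (hs' n).2.2, ?_, ?_⟩, projTendsto_toProj hf, ?_⟩
    · simpa using orthogonal_dirLine (a := envPoint B p q) (hgs n) 0
    · have e := (hs' n).1.1
      have := orthogonal_dirLine (a := envPoint B p q) (hgs n) ((s n - t₀) ^ k)
      have e' := sub_eq_iff_eq_add'.1 e
      rwa [← e'] at this
    · have hlg : linForm l (g t₀) = 0 := linForm_eq_zero_of_direction hqp hgdir hdir hl0
      rw [mk_eq_mk_dirLine hl hg0 hla hlg]
      exact projTendsto_dirLine hg0 hgs (hg.tendsto.comp hs)

/-- At an isolated point, which is central, the line meets the circle in some r and in `opposite a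
r`, with equal images. Otherwise a subsequence of the approaching points runs along one nonconstant
branch, and its limiting direction is the chord. -/
theorem exists_isChord_of_mem_dualCurve {L : RealPlane}
    (hL : L ∈ dualCurve (toProj '' interiorCurve B)) :
    ∃ p q, IsChord B p q ∧ Projectivization.orthogonal L (toProj p) ∧
      Projectivization.orthogonal L (toProj q) := by
  obtain ⟨_, ⟨a, ha, rfl⟩, hLa, hor⟩ := hL
  rcases hor with hi | ⟨R, M, hRM, hR, p, l, hp, hl, hM, rfl, hpl⟩
  · obtain ⟨l, hl, rfl⟩ := exists_eq_mk L
    rw [interiorCurve_eq h] at ha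
    obtain ⟨p, q, hpq, rfl⟩ := ha
    have hlt := h.norm_envPoint_lt_one hpq.norm_left hpq.norm_right hpq.ne
    have hc : IsCentral B (envPoint B p q) := by
      obtain ⟨t₀, P, Q, hP, hQ, hPQ⟩ := h.exists_chordBranch hpq
      rw [← hP, ← hQ] at hi ⊢
      exact h.isCentral_of_isIsolatedIn hPQ hi
    rw [orthogonal_mk_toProj] at hLa
    set a := envPoint B p q
    obtain ⟨r, hr, hlr⟩ := exists_norm_eq_one_of_line hl hlt hLa
    have hch := (eq_opposite_iff hlt hr).1 rfl
    have hra : r - a ≠ 0 := by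
      intro e
      rw [sub_eq_zero] at e
      rw [← e, hr] at hlt
      exact lt_irrefl _ hlt
    have h1 := linForm_eq_zero_of_direction (l := l) hra
      (right_sub_direction (norm_opposite hlt hr) hch) (left_sub_direction hr hch)
      (by rw [linForm_sub]; linarith)
    rw [linForm_sub] at h1
    refine ⟨r, opposite a r, hc.isChord hlt hr, (orthogonal_mk_toProj hl _).2 hlr,
      (orthogonal_mk_toProj hl _).2 (by linarith)⟩
  · choose z hz hzR using fun n => (hRM n).1
    obtain rfl : (fun n => toProj (z n)) = R := funext hzR
    obtain ⟨t₀, P, Q, hPQ, rfl, φ, s, hφ, hs, hzs⟩ :=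
      h.exists_branch_of_tendsto hz hR.tendsto_toProj
    have hconst : ¬ ∀ᶠ t in 𝓝 t₀, envPoint B (P t) (Q t) = envPoint B (P t₀) (Q t₀) := by
      intro hev
      obtain ⟨n, hn⟩ := (hs.eventually hev).exists
      exact (hRM (φ n)).2.1 (congrArg toProj ((hzs n).trans hn))
    have hPn := hPQ.left.norm_eq_one h
    have hQn := hPQ.right.norm_eq_one h
    have hchord := h.envPoint_chord hPn hQn
    obtain ⟨k, g, hg, hg0, hfg, hgdir⟩ := hPQ.exists_direction h hconst
    rw [orthogonal_mk_toProj] at hLa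
    -- The secant has direction (s - t₀)^k • g s; the scalar is nonzero because the two points
    -- differ.
    have hpg : ∀ᶠ n in atTop, linForm (p (φ n)) (g (s n)) = 0 := by
      filter_upwards [hs.eventually hfg] with n hn
      have h1 := (hRM (φ n)).2.2.1
      have h2 := (hRM (φ n)).2.2.2
      rw [← hM, orthogonal_mk_toProj] at h1 h2
      have h3 : linForm (p (φ n)) (z (φ n) - envPoint B (P t₀) (Q t₀)) = 0 := by
        rw [linForm_sub]; linarith
      have hne : z (φ n) - envPoint B (P t₀) (Q t₀) ≠ 0 := by
        rw [sub_ne_zero]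
        exact fun e => (hRM (φ n)).2.1 (congrArg toProj e)
      rw [hzs n, hn] at h3 hne
      rw [Complex.real_smul, linForm_real_mul, mul_eq_zero] at h3
      exact h3.resolve_left fun e => hne (by rw [e, zero_smul])
    have hlg : linForm l (g t₀) = 0 := by
      have hp' := tendsto_pi_nhds.1 (hpl.comp hφ)
      have hg' := hg.tendsto.comp hs
      refine tendsto_nhds_unique (((hp' 0).mul ((Complex.continuous_re.tendsto _).comp hg')).add
        ((hp' 1).mul ((Complex.continuous_im.tendsto _).comp hg'))) ?_
      exact tendsto_const_nhds.congr' (hpg.mono fun n hn => hn.symm)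
    have h1 := linForm_eq_zero_of_direction hg0 (left_sub_direction hPn hchord) hgdir hlg
    have h2 := linForm_eq_zero_of_direction hg0 (right_sub_direction hQn hchord) hgdir hlg
    rw [linForm_sub] at h1 h2
    exact ⟨P t₀, Q t₀, (hPQ.eventually_isChord h).self_of_nhds,
      (orthogonal_mk_toProj hl _).2 (by linarith), (orthogonal_mk_toProj hl _).2 (by linarith)⟩

theorem mem_affinePart_iff {w : ℂ} :
    w ∈ affinePart (dualCurve (homogenization (interiorCurve B))) ↔
      ∃ p q, IsChord B p q ∧ w.re * p.re + w.im * p.im + 1 = 0 ∧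
        w.re * q.re + w.im * q.im + 1 = 0 := by
  rw [homogenization_of_isCompact h.isCompact_interiorCurve, affinePart, Set.mem_preimage]
  have ho : ∀ z, Projectivization.orthogonal (toProj w) (toProj z) ↔
      w.re * z.re + w.im * z.im + 1 = 0 := fun z => by
    rw [toProj, orthogonal_mk_toProj]
    simp [linForm]
  simp only [← ho]
  exact ⟨h.exists_isChord_of_mem_dualCurve, fun ⟨p, q, hpq, h1, h2⟩ =>
    h.mem_dualCurve_of_isChord hpq h1 h2⟩

end CircleCover

/-! ### Finite Blaschke products -/

/-- Factors on the left may vanish, as |z - a k| does at a zero of B. -/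
theorem Finset.prod_lt_prod_of_nonneg_of_lt {ι : Type*} {s : Finset ι} {f g : ι → ℝ}
    (hs : s.Nonempty) (h0 : ∀ i ∈ s, 0 ≤ f i) (hlt : ∀ i ∈ s, f i < g i) :
    ∏ i ∈ s, f i < ∏ i ∈ s, g i := by
  by_cases hz : ∃ i ∈ s, f i = 0
  · obtain ⟨i, hi, e⟩ := hz
    rw [Finset.prod_eq_zero hi e]
    exact Finset.prod_pos fun i hi => (h0 i hi).trans_lt (hlt i hi)
  · push Not at hz
    exact Finset.prod_lt_prod_of_nonempty (fun i hi => (h0 i hi).lt_of_ne (hz i hi).symm) hlt hs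

/-- The numerator of a Blaschke product. -/
noncomputable def blaschkeNum {d : ℕ} (a : Fin d → ℂ) : Polynomial ℂ :=
  ∏ k, (Polynomial.X - Polynomial.C (a k))

/-- The denominator of a Blaschke product. -/
noncomputable def blaschkeDen {d : ℕ} (a : Fin d → ℂ) : Polynomial ℂ :=
  ∏ k, (1 - Polynomial.C (conj (a k)) * Polynomial.X)

section Blaschke

variable {d : ℕ} (a : Fin d → ℂ)

theorem eval_blaschkeNum (z : ℂ) : (blaschkeNum a).eval z = ∏ k, (z - a k) := by
  simp [blaschkeNum, Polynomial.eval_prod]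

theorem eval_blaschkeDen (z : ℂ) : (blaschkeDen a).eval z = ∏ k, (1 - conj (a k) * z) := by
  simp [blaschkeDen, Polynomial.eval_prod]

theorem natDegree_blaschkeNum_le : (blaschkeNum a).natDegree ≤ d := by
  refine (Polynomial.natDegree_prod_le _ _).trans ?_
  refine (Finset.sum_le_card_nsmul _ _ 1 fun k _ => ?_).trans (by simp)
  exact Polynomial.natDegree_X_sub_C_le _

theorem natDegree_blaschkeDen_le : (blaschkeDen a).natDegree ≤ d := by
  refine (Polynomial.natDegree_prod_le _ _).trans ?_
  refine (Finset.sum_le_card_nsmul _ _ 1 fun k _ => ?_).trans (by simp)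
  compute_degree

theorem blaschke_zero_eq_prod (z : ℂ) :
    blaschke 0 a z = ∏ k, (z - a k) / (1 - conj (a k) * z) := by
  simp [blaschke]

theorem blaschke_zero_eq (z : ℂ) :
    blaschke 0 a z = (blaschkeNum a).eval z / (blaschkeDen a).eval z := by
  rw [blaschke_zero_eq_prod, Finset.prod_div_distrib, eval_blaschkeNum, eval_blaschkeDen]

theorem normSq_one_sub_conj_mul (b z : ℂ) :
    ‖1 - conj b * z‖ ^ 2 - ‖z - b‖ ^ 2 = (1 - ‖b‖ ^ 2) * (1 - ‖z‖ ^ 2) := by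
  simp only [← Complex.normSq_eq_norm_sq, Complex.normSq_apply]
  simp
  ring

theorem norm_sub_lt {b z : ℂ} (hb : ‖b‖ < 1) (hz : ‖z‖ < 1) : ‖z - b‖ < ‖1 - conj b * z‖ := by
  refine lt_of_pow_lt_pow_left₀ 2 (norm_nonneg _) ?_
  have h1 : 0 < 1 - ‖b‖ ^ 2 := by nlinarith [norm_nonneg b]
  have h2 : 0 < 1 - ‖z‖ ^ 2 := by nlinarith [norm_nonneg z]
  have := mul_pos h1 h2
  rw [← normSq_one_sub_conj_mul] at this
  linarith

theorem norm_lt_norm_sub {b z : ℂ} (hb : ‖b‖ < 1) (hz : 1 < ‖z‖) : ‖1 - conj b * z‖ < ‖z - b‖ := by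
  refine lt_of_pow_lt_pow_left₀ 2 (norm_nonneg _) ?_
  have h1 : 0 < 1 - ‖b‖ ^ 2 := by nlinarith [norm_nonneg b]
  have h2 : 0 < ‖z‖ ^ 2 - 1 := by nlinarith
  have := mul_pos h1 h2
  have e := normSq_one_sub_conj_mul b z
  linarith

theorem norm_sub_eq {b z : ℂ} (hz : ‖z‖ = 1) : ‖z - b‖ = ‖1 - conj b * z‖ := by
  have e := normSq_one_sub_conj_mul b z
  rw [hz] at e
  refine (pow_left_inj₀ (norm_nonneg _) (norm_nonneg _) two_ne_zero).1 ?_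
  linarith

theorem sub_ne_zero_of_norm {b z : ℂ} (hb : ‖b‖ < 1) (hz : ‖z‖ = 1) : z - b ≠ 0 := by
  intro e
  rw [sub_eq_zero.1 e] at hz
  exact hb.ne hz

variable {a} (ha : ∀ k, ‖a k‖ < 1)
include ha

theorem eval_blaschkeDen_ne_zero {z : ℂ} (hz : ‖z‖ = 1) : (blaschkeDen a).eval z ≠ 0 := by
  rw [eval_blaschkeDen]
  exact Finset.prod_ne_zero_iff.2 fun k _ => one_sub_conj_mul_ne_zero (ha k) hz

theorem norm_blaschkeNum_lt (hd : 0 < d) {z : ℂ} (hz : ‖z‖ < 1) :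
    ‖(blaschkeNum a).eval z‖ < ‖(blaschkeDen a).eval z‖ := by
  have : Nonempty (Fin d) := ⟨⟨0, hd⟩⟩
  rw [eval_blaschkeNum, eval_blaschkeDen, norm_prod, norm_prod]
  exact Finset.prod_lt_prod_of_nonneg_of_lt Finset.univ_nonempty (fun _ _ => norm_nonneg _)
    fun k _ => norm_sub_lt (ha k) hz

theorem norm_blaschkeDen_lt (hd : 0 < d) {z : ℂ} (hz : 1 < ‖z‖) :
    ‖(blaschkeDen a).eval z‖ < ‖(blaschkeNum a).eval z‖ := by
  have : Nonempty (Fin d) := ⟨⟨0, hd⟩⟩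
  rw [eval_blaschkeNum, eval_blaschkeDen, norm_prod, norm_prod]
  exact Finset.prod_lt_prod_of_nonneg_of_lt Finset.univ_nonempty (fun _ _ => norm_nonneg _)
    fun k _ => norm_lt_norm_sub (ha k) hz

theorem norm_blaschke_eq_one_iff (hd : 0 < d) (z : ℂ) : ‖blaschke 0 a z‖ = 1 ↔ ‖z‖ = 1 := by
  constructor
  · intro h
    rw [blaschke_zero_eq, norm_div] at h
    -- At a pole the quotient has the default value 0, whose norm is not 1.
    have h0 : ‖(blaschkeDen a).eval z‖ ≠ 0 := by
      intro e
      simp [e] at h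
    rw [div_eq_one_iff_eq h0] at h
    rcases lt_trichotomy ‖z‖ 1 with h1 | h1 | h1
    · exact absurd h (norm_blaschkeNum_lt ha hd h1).ne
    · exact h1
    · exact absurd h (norm_blaschkeDen_lt ha hd h1).ne'
  · intro h
    rw [blaschke_zero_eq_prod, norm_prod]
    refine Finset.prod_eq_one fun k _ => ?_
    rw [norm_div, norm_sub_eq h, div_self]
    exact norm_ne_zero_iff.2 (one_sub_conj_mul_ne_zero (ha k) h)

/-- The logarithmic derivative turns the product into a sum, and on the circle each factor
contributes a Poisson kernel; positivity is read off from this. -/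
theorem weight_blaschke {z : ℂ} (hz : ‖z‖ = 1) :
    weight (blaschke 0 a) z = ((∑ k, (1 - ‖a k‖ ^ 2) / ‖z - a k‖ ^ 2 : ℝ) : ℂ) := by
  have hz0 := ne_zero_of_norm_eq_one hz
  have hfun : blaschke 0 a = fun z => ∏ k, (fun z => (z - a k) / (1 - conj (a k) * z)) z :=
    funext (blaschke_zero_eq_prod a)
  have hd1 : ∀ (b : ℂ), DifferentiableAt ℂ (fun z : ℂ => z - b) z := fun b => by fun_prop
  have hd2 : ∀ (b : ℂ), DifferentiableAt ℂ (fun z : ℂ => 1 - conj b * z) z := fun b => by fun_prop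
  rw [weight, mul_div_assoc, ← logDeriv_apply, hfun,
    logDeriv_prod (s := Finset.univ) (f := fun k z => (z - a k) / (1 - conj (a k) * z))
    (fun k _ => div_ne_zero (sub_ne_zero_of_norm (ha k) hz) (one_sub_conj_mul_ne_zero (ha k) hz))
    (fun k _ => (hd1 _).div (hd2 _) (one_sub_conj_mul_ne_zero (ha k) hz)), Finset.mul_sum]
  push_cast
  refine Finset.sum_congr rfl fun k _ => ?_
  have h1 := sub_ne_zero_of_norm (ha k) hz
  have h2 := one_sub_conj_mul_ne_zero (ha k) hz
  have e2 : HasDerivAt (fun z : ℂ => 1 - conj (a k) * z) (-conj (a k)) z := by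
    simpa using ((hasDerivAt_id z).const_mul (conj (a k))).const_sub 1
  rw [logDeriv_div z h1 h2 (hd1 _) (hd2 _), logDeriv_apply, logDeriv_apply, e2.deriv,
    ((hasDerivAt_id' z).sub_const (a k)).deriv]
  rw [← Complex.mul_conj', ← Complex.mul_conj', map_sub, conj_eq_inv_of_norm_eq_one hz]
  have h3 : z⁻¹ - conj (a k) ≠ 0 := by
    rw [← conj_eq_inv_of_norm_eq_one hz, ← map_sub]
    exact (map_ne_zero _).2 h1
  have h4 : z⁻¹ - conj (a k) = (1 - conj (a k) * z) / z := by field_simp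
  have h5 : 1 - z * conj (a k) ≠ 0 := by rwa [mul_comm]
  rw [h4]
  field_simp
  ring

theorem circleCover_blaschke (hd : 0 < d) : CircleCover (blaschke 0 a) where
  norm_eq_one_iff := norm_blaschke_eq_one_iff ha hd
  analyticAt z hz := by
    have hfun : blaschke 0 a = fun z => (blaschkeNum a).eval z / (blaschkeDen a).eval z :=
      funext (blaschke_zero_eq a)
    rw [hfun]
    exact ((blaschkeNum a).differentiable.analyticAt z).div
      ((blaschkeDen a).differentiable.analyticAt z) (eval_blaschkeDen_ne_zero ha hz)
  weight_pos z hz := by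
    have : Nonempty (Fin d) := ⟨⟨0, hd⟩⟩
    refine ⟨_, Finset.sum_pos (fun k _ => ?_) Finset.univ_nonempty, weight_blaschke ha hz⟩
    have h1 : 0 < 1 - ‖a k‖ ^ 2 := by nlinarith [ha k, norm_nonneg (a k)]
    have h2 := norm_pos_iff.2 (sub_ne_zero_of_norm (ha k) hz)
    positivity

theorem blaschke_eq_iff {p q : ℂ} (hp : ‖p‖ = 1) (hq : ‖q‖ = 1) :
    blaschke 0 a p = blaschke 0 a q ↔
      (blaschkeNum a).eval p * (blaschkeDen a).eval q
        = (blaschkeNum a).eval q * (blaschkeDen a).eval p := by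
  rw [blaschke_zero_eq, blaschke_zero_eq, div_eq_div_iff (eval_blaschkeDen_ne_zero ha hp)
    (eval_blaschkeDen_ne_zero ha hq)]

end Blaschke

/-! ### A polynomial that vanishes on the lines joining preimages -/

/-- With h_n = (p^(n+1) - q^(n+1))/(p - q), the recursion h_(n+2) = (p + q) h_(n+1) - pq h_n
becomes, after multiplication by y^(n+2), v_(n+2) = -2 v_(n+1) - x y v_n. -/
theorem exists_mvPolynomial_pow_sub_pow (n : ℕ) :
    ∃ v : MvPolynomial (Fin 2) ℂ, ∀ x y p q : ℂ, y * (p + q) = -2 → y * (p * q) = x →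
      (p - q) * MvPolynomial.eval ![x, y] v = y ^ n * (p ^ (n + 1) - q ^ (n + 1)) := by
  induction n using Nat.twoStepInduction with
  | zero => exact ⟨1, fun x y p q _ _ => by simp⟩
  | one =>
    refine ⟨MvPolynomial.C (-2), fun x y p q h1 h2 => ?_⟩
    simp only [MvPolynomial.eval_C]
    linear_combination (q - p) * h1
  | more n ih1 ih2 =>
    obtain ⟨v, hv⟩ := ih1
    obtain ⟨w, hw⟩ := ih2
    refine ⟨MvPolynomial.C (-2) * w - MvPolynomial.X 0 * MvPolynomial.X 1 * v,
      fun x y p q h1 h2 => ?_⟩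
    have e1 := hv x y p q h1 h2
    have e2 := hw x y p q h1 h2
    simp only [map_sub, map_mul, MvPolynomial.eval_C, MvPolynomial.eval_X, Matrix.cons_val_zero,
      Matrix.cons_val_one]
    linear_combination (-2) * e2 - x * y * e1 -
      y ^ (n + 1) * (p ^ (n + 2) - q ^ (n + 2)) * h1 +
      y ^ (n + 1) * (p ^ (n + 1) - q ^ (n + 1)) * h2

/-- With j = k + n + 1 and d = j + m, the power y^(d-1) splits as y^k for (pq)^k, y^n for the
difference of powers, and a spare y^m. -/
theorem exists_mvPolynomial_monomial {d j k : ℕ} (hkj : k < j) (hj : j ≤ d) :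
    ∃ v : MvPolynomial (Fin 2) ℂ, ∀ x y p q : ℂ, y * (p + q) = -2 → y * (p * q) = x →
      (p - q) * MvPolynomial.eval ![x, y] v = y ^ (d - 1) * (p ^ j * q ^ k - q ^ j * p ^ k) := by
  obtain ⟨n, rfl⟩ := Nat.exists_eq_add_of_lt hkj
  obtain ⟨m, rfl⟩ := Nat.exists_eq_add_of_le hj
  obtain ⟨v, hv⟩ := exists_mvPolynomial_pow_sub_pow n
  refine ⟨MvPolynomial.X 0 ^ k * MvPolynomial.X 1 ^ m * v, fun x y p q h1 h2 => ?_⟩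
  have e := hv x y p q h1 h2
  simp only [map_mul, map_pow, MvPolynomial.eval_X, Matrix.cons_val_zero, Matrix.cons_val_one]
  rw [show k + n + 1 + m - 1 = k + n + m by omega]
  calc (p - q) * (x ^ k * y ^ m * MvPolynomial.eval ![x, y] v)
      = x ^ k * y ^ m * (y ^ n * (p ^ (n + 1) - q ^ (n + 1))) := by rw [← e]; ring
    _ = _ := by rw [← h2]; ring

theorem exists_mvPolynomial_antisymm {d : ℕ} {N D : Polynomial ℂ} (hN : N.natDegree ≤ d)
    (hD : D.natDegree ≤ d) :
    ∃ v : MvPolynomial (Fin 2) ℂ, ∀ x y p q : ℂ, y * (p + q) = -2 → y * (p * q) = x →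
      (p - q) * MvPolynomial.eval ![x, y] v
        = y ^ (d - 1) * (N.eval p * D.eval q - N.eval q * D.eval p) := by
  have key : ∀ j ∈ Finset.range (d + 1), ∀ k ∈ Finset.range (d + 1),
      ∃ v : MvPolynomial (Fin 2) ℂ, ∀ x y p q : ℂ, y * (p + q) = -2 → y * (p * q) = x →
        (p - q) * MvPolynomial.eval ![x, y] v
          = y ^ (d - 1) * (p ^ j * q ^ k - q ^ j * p ^ k) := by
    intro j hj k hk
    rw [Finset.mem_range, Nat.lt_succ_iff] at hj hk
    rcases lt_trichotomy k j with h | rfl | h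
    · exact exists_mvPolynomial_monomial h hj
    · exact ⟨0, fun x y p q _ _ => by simp; right; ring⟩
    · obtain ⟨v, hv⟩ := exists_mvPolynomial_monomial h hk
      refine ⟨-v, fun x y p q h1 h2 => ?_⟩
      rw [map_neg]
      linear_combination -hv x y p q h1 h2
  choose! v hv using key
  refine ⟨∑ j ∈ Finset.range (d + 1), ∑ k ∈ Finset.range (d + 1),
    MvPolynomial.C (N.coeff j * D.coeff k) * v j k, fun x y p q h1 h2 => ?_⟩
  simp only [Polynomial.eval_eq_sum_range' (Nat.lt_succ_of_le hN),
    Polynomial.eval_eq_sum_range' (Nat.lt_succ_of_le hD)]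
  rw [Finset.sum_mul_sum, Finset.sum_mul_sum, ← Finset.sum_sub_distrib, Finset.mul_sum, map_sum,
    Finset.mul_sum]
  refine Finset.sum_congr rfl fun j hj => ?_
  rw [← Finset.sum_sub_distrib, Finset.mul_sum, map_sum, Finset.mul_sum]
  refine Finset.sum_congr rfl fun k hk => ?_
  rw [map_mul, MvPolynomial.eval_C]
  linear_combination N.coeff j * D.coeff k * hv j hj k hk x y p q h1 h2

/-! ### Roots on a dual line and the zero set of the polynomial -/

theorem line_iff {w p : ℂ} (hp : ‖p‖ = 1) :
    w.re * p.re + w.im * p.im + 1 = 0 ↔ conj w * p ^ 2 + 2 * p + w = 0 := by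
  have hp0 := ne_zero_of_norm_eq_one hp
  have e : ((w.re * p.re + w.im * p.im + 1 : ℝ) : ℂ) * (2 * p) = conj w * p ^ 2 + 2 * p + w := by
    have h1 : ((w.re * p.re + w.im * p.im : ℝ) : ℂ) * 2 = conj w * p + w * conj p := by
      apply Complex.ext
      · simp; ring
      · simp; ring
    rw [conj_eq_inv_of_norm_eq_one hp] at h1
    rw [Complex.ofReal_add, Complex.ofReal_one]
    calc _ = ((w.re * p.re + w.im * p.im : ℝ) : ℂ) * 2 * p + 2 * p := by ring
      _ = _ := by
        rw [h1]
        field_simp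
        ring
  rw [← e, mul_eq_zero, Complex.ofReal_eq_zero, or_iff_left (by simpa using hp0)]

theorem lines_iff {w p q : ℂ} (hp : ‖p‖ = 1) (hq : ‖q‖ = 1) (hpq : p ≠ q) :
    (w.re * p.re + w.im * p.im + 1 = 0 ∧ w.re * q.re + w.im * q.im + 1 = 0) ↔
      conj w * (p + q) = -2 ∧ conj w * (p * q) = w := by
  rw [line_iff hp, line_iff hq]
  constructor
  · rintro ⟨h1, h2⟩
    have h3 : conj w * (p + q) = -2 := by
      refine mul_left_cancel₀ (sub_ne_zero.2 hpq) ?_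
      linear_combination h1 - h2
    exact ⟨h3, by linear_combination p * h3 - h1⟩
  · rintro ⟨h1, h2⟩
    exact ⟨by linear_combination p * h1 - h2, by linear_combination q * h1 - h2⟩

/-- These are the roots of conj w X² + 2X + w, where δ² is a quarter of the discriminant. -/
theorem vieta {w δ : ℂ} (hw : w ≠ 0) (hδ : δ ^ 2 = 1 - w * conj w) :
    conj w * ((-1 + δ) / conj w + (-1 - δ) / conj w) = -2 ∧
      conj w * ((-1 + δ) / conj w * ((-1 - δ) / conj w)) = w := by
  have hw' : conj w ≠ 0 := by simpa using hw
  constructor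
  · field_simp
    ring
  · field_simp
    linear_combination -hδ

section

variable {d : ℕ} {a : Fin d → ℂ} (ha : ∀ k, ‖a k‖ < 1) {v : MvPolynomial (Fin 2) ℂ}
  (hv : ∀ x y p q : ℂ, y * (p + q) = -2 → y * (p * q) = x →
    (p - q) * MvPolynomial.eval ![x, y] v = y ^ (d - 1) *
      ((blaschkeNum a).eval p * (blaschkeDen a).eval q -
        (blaschkeNum a).eval q * (blaschkeDen a).eval p))
include hv

/-- The identity for v says nothing at y = 0, so the value is a limit along x = 0, y → 0, with roots
0 and -2/y. Since N(0) = 0, only N(-2/y) D(0) remains, and the limit is -(-2)^d / 2. -/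
theorem evalZ_zero_ne_zero (hd : 0 < d) (h0 : (blaschkeNum a).eval 0 = 0) : evalZ v 0 ≠ 0 := by
  have hval : ∀ y : ℂ, y ≠ 0 →
      MvPolynomial.eval ![0, y] v = -(1 / 2) * ∏ k, (-2 - a k * y) := by
    intro y hy
    have e := hv 0 y 0 (-2 / y) (by field_simp; ring) (by ring)
    have hD : (blaschkeDen a).eval 0 = 1 := by simp [eval_blaschkeDen]
    have hN : y ^ d * (blaschkeNum a).eval (-2 / y) = ∏ k, (-2 - a k * y) := by
      rw [eval_blaschkeNum, ← Fin.prod_const, ← Finset.prod_mul_distrib]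
      refine Finset.prod_congr rfl fun k _ => ?_
      field_simp
    rw [h0, hD] at e
    have hpow : y ^ d = y ^ (d - 1) * y := by rw [← pow_succ, Nat.sub_add_cancel hd]
    calc MvPolynomial.eval ![0, y] v
        = y / 2 * ((0 - -2 / y) * MvPolynomial.eval ![0, y] v) := by
          field_simp
          ring
      _ = _ := by
          rw [e, ← hN, hpow]
          ring
  have hc1 : Continuous fun y : ℂ => MvPolynomial.eval ![0, y] v := by
    refine (MvPolynomial.continuous_eval v).comp ?_
    refine continuous_pi fun i => ?_
    fin_cases i
    · exact continuous_const
    · exact continuous_id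
  have hc2 : Continuous fun y : ℂ => -(1 / 2) * ∏ k, (-2 - a k * y) := by fun_prop
  have e : MvPolynomial.eval ![0, 0] v = -(1 / 2) * ∏ k, (-2 - a k * 0) := by
    refine tendsto_nhds_unique (hc1.continuousAt.tendsto.mono_left (nhdsWithin_le_nhds (s := {0}ᶜ)))
      ((hc2.continuousAt.tendsto.mono_left nhdsWithin_le_nhds).congr' ?_)
    filter_upwards [self_mem_nhdsWithin (a := (0 : ℂ)) (s := {0}ᶜ)] with y hy using (hval y hy).symm
  simp only [evalZ, map_zero, e]
  simp

include ha

/-- Here the roots coincide at q = -w. Letting p → q, with x and y treated as independent variables,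
v becomes a nonzero multiple of the difference quotient of B, which tends to B'(q) ≠ 0. -/
theorem evalZ_ne_zero_of_norm_eq_one (hd : 0 < d) {w : ℂ} (hw : ‖w‖ = 1) : evalZ v w ≠ 0 := by
  have h := circleCover_blaschke ha hd
  have hw0 := ne_zero_of_norm_eq_one hw
  have hn : ‖-w‖ = 1 := by rw [norm_neg, hw]
  set q := -w with hq
  have hq0 : q ≠ 0 := neg_ne_zero.2 hw0
  have hval : ∀ p : ℂ, p ≠ q → p + q ≠ 0 → (blaschkeDen a).eval p ≠ 0 →
      MvPolynomial.eval ![-2 / (p + q) * (p * q), -2 / (p + q)] v = (-2 / (p + q)) ^ (d - 1) *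
        ((blaschkeDen a).eval p * (blaschkeDen a).eval q * slope (blaschke 0 a) q p) := by
    intro p hpq hs hD
    have e := hv _ (-2 / (p + q)) p q (by field_simp) rfl
    have hDq := eval_blaschkeDen_ne_zero ha hn
    rw [slope_def_field, blaschke_zero_eq, blaschke_zero_eq]
    have hpq' := sub_ne_zero.2 hpq
    refine mul_left_cancel₀ hpq' ?_
    rw [e]
    field_simp
  have hcy : ContinuousAt (fun p : ℂ => -2 / (p + q)) q := by
    have : q + q ≠ 0 := by simpa [← two_mul] using hq0
    fun_prop (disch := assumption)
  have hc1 : ContinuousAt (fun p : ℂ =>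
      MvPolynomial.eval ![-2 / (p + q) * (p * q), -2 / (p + q)] v) q := by
    refine (MvPolynomial.continuous_eval v).continuousAt.comp ?_
    refine continuousAt_pi.2 fun i => ?_
    fin_cases i
    · exact hcy.mul (continuousAt_id.mul continuousAt_const)
    · exact hcy
  have hc3 := hasDerivAt_iff_tendsto_slope.1 (h.analyticAt q hn).differentiableAt.hasDerivAt
  have hcD : ContinuousAt (fun p => (blaschkeDen a).eval p) q :=
    (blaschkeDen a).continuous.continuousAt
  have hc2 : Tendsto (fun p => (-2 / (p + q)) ^ (d - 1) * ((blaschkeDen a).eval p *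
      (blaschkeDen a).eval q * slope (blaschke 0 a) q p)) (𝓝[≠] q) (𝓝 ((-2 / (q + q)) ^ (d - 1) *
      ((blaschkeDen a).eval q * (blaschkeDen a).eval q * deriv (blaschke 0 a) q))) :=
    ((hcy.pow (d - 1)).tendsto.mono_left (nhdsWithin_le_nhds (s := {q}ᶜ))).mul
    (((hcD.tendsto.mono_left (nhdsWithin_le_nhds (s := {q}ᶜ))).mul_const
      ((blaschkeDen a).eval q)).mul hc3)
  have hDq := eval_blaschkeDen_ne_zero ha hn
  have hqq : q + q ≠ 0 := by simpa [← two_mul] using hq0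
  have e := tendsto_nhds_unique (hc1.tendsto.mono_left (nhdsWithin_le_nhds (s := {q}ᶜ)))
    (hc2.congr' (by
      have hs : ∀ᶠ p : ℂ in 𝓝 q, p + q ≠ 0 :=
        (continuousAt_id.add continuousAt_const).eventually_ne hqq
      filter_upwards [nhdsWithin_le_nhds hs, nhdsWithin_le_nhds (hcD.eventually_ne hDq),
        self_mem_nhdsWithin] with p h1 h2 h3
      exact (hval p h3 h1 h2).symm))
  have hy : -2 / (q + q) = conj w := by
    rw [conj_eq_inv_of_norm_eq_one hw, hq]
    field_simp
    ring
  have hx : conj w * (q * q) = w := by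
    rw [conj_eq_inv_of_norm_eq_one hw, hq]
    field_simp
  rw [hy, hx] at e
  rw [evalZ, e]
  exact mul_ne_zero (pow_ne_zero _ (by simpa using hw0))
    (mul_ne_zero (mul_ne_zero hDq hDq) (h.deriv_ne_zero hn))

/-- One root p is inside the disc and the other, q, outside, so |N(p)| < |D(p)| and |D(q)| < |N(q)|,
which contradicts N(p)D(q) = N(q)D(p). -/
theorem evalZ_ne_zero_of_norm_lt_one (hd : 0 < d) {w : ℂ} (hw : ‖w‖ < 1) (hw0 : w ≠ 0) :
    evalZ v w ≠ 0 := by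
  have hwn : 0 < ‖w‖ := norm_pos_iff.2 hw0
  have hpos : 0 < 1 - ‖w‖ ^ 2 := by nlinarith
  set r := √(1 - ‖w‖ ^ 2) with hr
  have hr0 : 0 < r := Real.sqrt_pos.2 hpos
  have hr2 : r ^ 2 = 1 - ‖w‖ ^ 2 := Real.sq_sqrt hpos.le
  have hδ : (r : ℂ) ^ 2 = 1 - w * conj w := by
    rw [Complex.mul_conj', ← Complex.ofReal_pow, hr2]
    push_cast
    rfl
  obtain ⟨h1, h2⟩ := vieta hw0 hδ
  have hp : ‖(-1 + (r : ℂ)) / conj w‖ < 1 := by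
    rw [norm_div, RCLike.norm_conj, div_lt_one hwn]
    have : ‖(-1 + (r : ℂ))‖ = 1 - r := by
      rw [← norm_neg, show -(-1 + (r : ℂ)) = ((1 - r : ℝ) : ℂ) by push_cast; ring,
        Complex.norm_real, Real.norm_of_nonneg]
      nlinarith
    rw [this]
    nlinarith
  have hq : 1 < ‖(-1 - (r : ℂ)) / conj w‖ := by
    rw [norm_div, RCLike.norm_conj, one_lt_div hwn]
    have : ‖(-1 - (r : ℂ))‖ = 1 + r := by
      rw [← norm_neg, show -(-1 - (r : ℂ)) = ((1 + r : ℝ) : ℂ) by push_cast; ring,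
        Complex.norm_real, Real.norm_of_nonneg]
      positivity
    rw [this]
    linarith
  have e := hv _ _ _ _ h1 h2
  set p := (-1 + (r : ℂ)) / conj w
  set q := (-1 - (r : ℂ)) / conj w
  intro h0
  rw [evalZ] at h0
  rw [h0, mul_zero, eq_comm, mul_eq_zero, or_iff_right (pow_ne_zero _ (by simpa using hw0)),
    sub_eq_zero] at e
  have hN := norm_blaschkeNum_lt ha hd hp
  have hD := norm_blaschkeDen_lt ha hd hq
  have e' := congrArg norm e
  rw [norm_mul, norm_mul] at e'
  have := mul_lt_mul'' hN hD (norm_nonneg _) (norm_nonneg _)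
  rw [e', mul_comm] at this
  exact lt_irrefl _ this

theorem evalZ_eq_zero_iff (hd : 0 < d) (h0 : (blaschkeNum a).eval 0 = 0) (w : ℂ) :
    evalZ v w = 0 ↔ ∃ p q, IsChord (blaschke 0 a) p q ∧ w.re * p.re + w.im * p.im + 1 = 0 ∧
        w.re * q.re + w.im * q.im + 1 = 0 := by
  constructor
  · intro hz
    have hw : 1 < ‖w‖ := by
      by_contra! hle
      rcases hle.lt_or_eq with hlt | heq
      · rcases eq_or_ne w 0 with rfl | hw0
        · exact evalZ_zero_ne_zero hv hd h0 hz
        · exact evalZ_ne_zero_of_norm_lt_one ha hv hd hlt hw0 hz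
      · exact evalZ_ne_zero_of_norm_eq_one ha hv hd heq hz
    have hwn : 0 < ‖w‖ := by linarith
    have hw0 : w ≠ 0 := norm_pos_iff.1 hwn
    have hw0' : conj w ≠ 0 := by simpa using hw0
    have hpos : 0 < ‖w‖ ^ 2 - 1 := by nlinarith
    set r := √(‖w‖ ^ 2 - 1) with hr
    have hr0 : 0 < r := Real.sqrt_pos.2 hpos
    have hr2 : r ^ 2 = ‖w‖ ^ 2 - 1 := Real.sq_sqrt hpos.le
    have hδ : ((r : ℂ) * Complex.I) ^ 2 = 1 - w * conj w := by
      rw [Complex.mul_conj', mul_pow, Complex.I_sq, ← Complex.ofReal_pow, hr2]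
      push_cast
      ring
    obtain ⟨h1, h2⟩ := vieta hw0 hδ
    -- For |w| > 1 the discriminant is negative, so both numerators have squared modulus 1 + r² =
    -- |w|².
    have hnorm : ∀ s : ℝ, s ^ 2 = r ^ 2 → ‖(-1 + (s : ℂ) * Complex.I) / conj w‖ = 1 := by
      intro s hs
      rw [norm_div, RCLike.norm_conj, div_eq_one_iff_eq hwn.ne']
      refine (pow_left_inj₀ (norm_nonneg _) (norm_nonneg _) two_ne_zero).1 ?_
      rw [← Complex.normSq_eq_norm_sq, Complex.normSq_apply]
      simp
      linarith
    have hp := hnorm r rfl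
    have hq := hnorm (-r) (by ring)
    rw [Complex.ofReal_neg, neg_mul, ← sub_eq_add_neg] at hq
    have hpq : (-1 + (r : ℂ) * Complex.I) / conj w ≠ (-1 - (r : ℂ) * Complex.I) / conj w := by
      intro e
      rw [div_left_inj' hw0'] at e
      have := congrArg Complex.im e
      simp at this
      linarith
    have e := hv _ _ _ _ h1 h2
    refine ⟨_, _, ⟨hp, hq, hpq, ?_⟩, (lines_iff hp hq hpq).2 ⟨h1, h2⟩⟩
    rw [evalZ] at hz
    rw [hz, mul_zero, eq_comm, mul_eq_zero, or_iff_right (pow_ne_zero _ hw0'),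
      sub_eq_zero] at e
    exact (blaschke_eq_iff ha hp hq).2 e
  · rintro ⟨p, q, hpq, hl⟩
    obtain ⟨h1, h2⟩ := (lines_iff hpq.norm_left hpq.norm_right hpq.ne).1 hl
    have e := hv _ _ _ _ h1 h2
    rw [(blaschke_eq_iff ha hpq.norm_left hpq.norm_right).1 hpq.map_eq, sub_self, mul_zero,
      mul_eq_zero, or_iff_right (sub_ne_zero.2 hpq.ne)] at e
    exact e

end

/-! ### The exterior curve and the conclusion -/

/-- The tangent at p is Re(conj p z) = 1, whereas dual coordinates (w : 1) give Re(w conj p) = -1: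
this is the origin of the sign in the theorem. -/
theorem mem_circleTangent_iff {p z : ℂ} (hp : ‖p‖ = 1) :
    z ∈ circleTangent p ↔ (-z).re * p.re + (-z).im * p.im + 1 = 0 := by
  have h1 : p.re * p.re + p.im * p.im = 1 := by
    rw [← Complex.normSq_apply, Complex.normSq_eq_norm_sq, hp, one_pow]
  rw [circleTangent, Set.mem_ofPred_eq, Complex.mul_re, Complex.conj_re, Complex.conj_im,
    Complex.sub_re, Complex.sub_im, Complex.neg_re, Complex.neg_im]
  constructor <;> intro e <;> linarith

theorem circleTangent_ne {p q : ℂ} (hp : ‖p‖ = 1) (hq : ‖q‖ = 1) (hpq : p ≠ q) :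
    circleTangent p ≠ circleTangent q := by
  intro e
  have h1 : p ∈ circleTangent q := by
    rw [← e]
    simp [circleTangent]
  rw [mem_circleTangent_iff hq] at h1
  have hp1 : p.re * p.re + p.im * p.im = 1 := by
    rw [← Complex.normSq_apply, Complex.normSq_eq_norm_sq, hp, one_pow]
  have hq1 : q.re * q.re + q.im * q.im = 1 := by
    rw [← Complex.normSq_apply, Complex.normSq_eq_norm_sq, hq, one_pow]
  simp only [Complex.neg_re, Complex.neg_im] at h1
  have h2 : Complex.normSq (p - q) = 0 := by
    rw [Complex.normSq_apply, Complex.sub_re, Complex.sub_im]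
    linarith
  exact hpq (sub_eq_zero.1 (Complex.normSq_eq_zero.1 h2))

theorem mem_exteriorCurve_iff {B : ℂ → ℂ} (h : CircleCover B) {z : ℂ} :
    z ∈ exteriorCurve B ↔ ∃ p q, IsChord B p q ∧ (-z).re * p.re + (-z).im * p.im + 1 = 0 ∧
        (-z).re * q.re + (-z).im * q.im + 1 = 0 := by
  constructor
  · rintro ⟨c, hc, _, ⟨p, hp, rfl⟩, _, ⟨q, hq, rfl⟩, hne, hzp, hzq⟩
    have hp' : B p = c := hp
    have hq' : B q = c := hq
    have hpn := (h.norm_eq_one_iff p).1 (by rw [hp', hc])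
    have hqn := (h.norm_eq_one_iff q).1 (by rw [hq', hc])
    exact ⟨p, q, ⟨hpn, hqn, fun e => hne (by rw [e]), hp'.trans hq'.symm⟩,
      (mem_circleTangent_iff hpn).1 hzp, (mem_circleTangent_iff hqn).1 hzq⟩
  · rintro ⟨p, q, hpq, hzp, hzq⟩
    exact ⟨B p, (h.norm_eq_one_iff p).2 hpq.norm_left, _, ⟨p, rfl, rfl⟩, _, ⟨q, hpq.map_eq.symm, rfl⟩,
      circleTangent_ne hpq.norm_left hpq.norm_right hpq.ne,
      (mem_circleTangent_iff hpq.norm_left).2 hzp, (mem_circleTangent_iff hpq.norm_right).2 hzq⟩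

theorem mainTheorem2 {d : ℕ} (θ : ℝ) (a : Fin d → ℂ) (ha : ∀ k, ‖a k‖ < 1)
    (hB : IsCanonical θ a) :
    (∃ v : MvPolynomial (Fin 2) ℂ, IsDefiningEquation v
      (affinePart (dualCurve (homogenization (interiorCurve (blaschke θ a)))))) ∧
    ∀ v : MvPolynomial (Fin 2) ℂ, IsDefiningEquation v
      (affinePart (dualCurve (homogenization (interiorCurve (blaschke θ a))))) →
      exteriorCurve (blaschke θ a) = {z | evalZ v (-z) = 0} := by
  obtain ⟨rfl, h0⟩ := hB
  -- For d = 0 the empty product is 1, which contradicts B(0) = 0.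
  have hd : 0 < d := by
    rcases Nat.eq_zero_or_pos d with rfl | hd
    · simp [blaschke] at h0
    · exact hd
  have h := circleCover_blaschke ha hd
  constructor
  · obtain ⟨v, hv⟩ := exists_mvPolynomial_antisymm (natDegree_blaschkeNum_le a)
      (natDegree_blaschkeDen_le a)
    have hN : (blaschkeNum a).eval 0 = 0 := by
      have hD : (blaschkeDen a).eval 0 = 1 := by simp [eval_blaschkeDen]
      rwa [blaschke_zero_eq, hD, div_one] at h0
    refine ⟨v, ?_, ?_⟩
    · rintro rfl
      exact evalZ_zero_ne_zero hv hd hN (by simp [evalZ])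
    · ext w
      rw [h.mem_affinePart_iff, Set.mem_ofPred_eq, evalZ_eq_zero_iff ha hv hd hN]
  · rintro v ⟨-, hv⟩
    ext z
    rw [mem_exteriorCurve_iff h, ← h.mem_affinePart_iff, hv]
    rfl
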